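/- **Setting.** Let $D\subset\mathbb R^2$ be a bounded polygonal domain with a finite conforming fine triangulation of mesh size $h$ and a coarse grid of mesh size $H$ (mesh sizes are maximal diameters) with blocks $K_1,\dots,K_N$, each a connected union of fine triangles; the coarse edges are segments, each shared by two blocks or lying on $\partial D$, and $N_E$ is the maximal number of edges of a block. Let $\kappa\ge1$ be measurable and bounded and $f\in L^2(D)$. Let $\kappa_K=\max_K\kappa$, let $\overline\kappa$ on an edge be the average of $\kappa_K$ over the adjacent blocks, and $\widetilde\kappa=\max_{E\subset\partial K_i}\overline\kappa$. Let $V_h(K_i)$ be the continuous piecewise linear functions on $K_i$, $V^{i}_2=V_h^0(K_i)$ those vanishing on $\partial K_i$, $V^{i}_1$ the discrete harmonic functions ($\int_{K_i}\kappa\nabla v\cdot\nabla w=0$ for all $w\in V_h^0(K_i)$), and $V^h_{DG}=\{v:\ v|_{K_i}\in V_h(K_i)\ \forall i\}$. With $\{\cdot\}$ and $[\cdot]$ the usual averages and jumps (one-sided values on $\partial D$), put $$a_{DG}(u,v)=\sum_i\int_{K_i}\kappa\nabla u\cdot\nabla v-\sum_E\int_E\big(\{\kappa\nabla u\cdot n_E\}[v]+\{\kappa\nabla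 v\cdot n_E\}[u]\big)+\frac{\gamma}{h}\sum_E\int_E\overline\kappa[u][v],$$ where the outward flux $\kappa\nabla u\cdot n$ on $\partial K_i$ is the element of $V_h(\partial K_i)=V_h(K_i)|_{\partial K_i}$ with $\int_{\partial K_i}(\kappa\nabla u\cdot n)v=\int_{K_i}\kappa\nabla u\cdot\nabla v$ for all $v\in V_1^i$. Let $C_{inv}\ge 0$ be the smallest constant with $\int_{K_i}\kappa|\nabla v|^2\le\kappa_{K_i}C_{inv}^2h^{-1}\int_{\partial K_i}v^2$ for all $i$ and $v\in V_1^i$. Assume $\gamma>C_{inv}^2$ and put $a_0=1-C_{inv}\gamma^{-1/2}$, $a_1=1+C_{inv}\gamma^{-1/2}$, $\|v\|_a^2=a_{DG}(v,v)$, and $C_{err}=1/a_0$. Let $(v,w)_{1,i}=H^{-1}\int_{\partial K_i}\widetilde\kappa vw$ and $(v,w)_{2,i}=H^{-2}\int_{K_i}\kappa vw$, with norms $\|\cdot\|_{j,i}$. For $j=1,2$ let $\lambda_{j,1}^{(i)}\le\lambda_{j,2}^{(i)}\le\cdots$ be the eigenvalues, counted with multiplicity, with an orthogonal eigenbasis of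 $V_j^i$, of $\int_{K_i}\kappa\nabla\phi\cdot\nabla v=\lambda(\phi,v)_{j,i}$ for all $v\in V_j^i$. Set $1/\lambda^{(i)}_{j,l+1}=0$ if $l=\dim V^i_j$, and $\Lambda_{j,i}=\max_l\lambda^{(i)}_{j,l}$. For numbers $l_{j,i}$, the offline space consists of the functions whose restriction to each $K_i$ is in the span of the first $l_{1,i}$ eigenfunctions of $V^i_1$ and the first $l_{2,i}$ of $V^i_2$; $P_{j,i}$ is the $(\cdot,\cdot)_{j,i}$-orthogonal projection of $V_j^i$ onto the span of its first $l_{j,i}$ eigenfunctions. Let $u_h\in V^h_{DG}$ satisfy $a_{DG}(u_h,v)=(f,v)$ for all $v\in V^h_{DG}$. **Adaptive algorithm** (marking parameter $0<\theta<1$, enrichment ratio $0<\delta<1$). Start with numbers $l^0_{j,i}$, where $l_{1,i}^0\ge1$. At level $m=0,1,\dots$ let $u_H^m$ be the Galerkin solution in the offline space of the numbers $l^m_{j,i}$. Put $R_{j,i}(v)=\int_{K_i}fv-a_{DG}(u_H^m,v)$ for $v\in V^i_j$ (extended by zero), $\eta_{j,i}^2=\|R_{j,i}\|^2/\lambda^{(i)}_{j,l^m_{j,i}+1}$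 with $\|R_{j,i}\|=\sup_{v\in V^i_j}|R_{j,i}(v)|/\|v\|_{j,i}$, and $$S^m_{j,i}=\big(\lambda^{(i)}_{j,l^m_{j,i}+1}\big)^{-1/2}\sup_{v\in V_j^i}\frac{|R_{j,i}(v-P_{j,i}v)|}{\|v\|_{j,i}}.$$ Write $J=(j,i)$. Mark a set $I$ of indices with $\theta^2\sum_J\eta_J^2\le\sum_{J\in I}\eta_J^2$. For $J\in I$ add eigenfunctions until $1/\lambda^{(i)}_{j,l^{m+1}_{j,i}+1}\le\delta/\lambda^{(i)}_{j,l^m_{j,i}+1}$; leave $l_J$ unchanged for $J\notin I$. **Theorem.** There is $\alpha>0$ with $\rho:=(1+\alpha)(1-(1-\delta)\theta^2)<1$. For every such $\alpha$ one has $\rho>0$, and the following holds. Put $$c_m=N_E(1+\alpha^{-1})a_1\max_{i,j}\frac{\Lambda_{j,i}+\gamma H/h}{\lambda^{(i)}_{j,l^m_{j,i}+1}},$$ and call positive numbers $L_0,L_1,\dots$ admissible if $c_m\le\delta L_m$ and $\rho L_m<L_{m+1}$ for all $m$. 1. There is a constant $L>0$, independent of $f$ and of the run of the algorithm, such that $L_m=L$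 is admissible for every run. 2. For every run and every $m$, $\|u_h-u_H^m\|_a^2\le C_{err}\sum_J\eta_J^2$, with $\eta_J$ computed at level $m$. 3. For every run, all admissible $L_m$ and every $m\ge0$, $$\|u_h-u_H^{m+1}\|_a^2+\frac1{\delta L_{m+1}}\sum_J(S_J^{m+1})^2\le\varepsilon\Big(\|u_h-u_H^m\|_a^2+\frac1{\delta L_m}\sum_J(S_J^m)^2\Big),\qquad \varepsilon=1-\frac{\theta^2(1-\rho L_m/L_{m+1})}{\theta^2+C_{err}\delta L_m}\in(0,1),$$ where the sums run over all $2N$ indices. 4. For every run, $\|u_h-u_H^m\|_a\to0$ as $m\to\infty$. -/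

import Mathlib

open MeasureTheory Filter Topology

noncomputable section

namespace GMsDG

/-- The Euclidean plane. -/
abbrev Plane : Type := EuclideanSpace ℝ (Fin 2)

/-- A two-scale grid of a bounded polygonal domain.  The fine grid is a finite conforming
triangulation.  The coarse blocks, indexed by `ι`, are connected unions of fine triangles, each fine
triangle lying in exactly one block.  The coarse edges, indexed by `ε`, are segments; an edge `e`
separates the block `plus e` from the block `j` if `minus e = some j`, and lies on the boundary of
the domain if `minus e = none`.  The boundary of a block is the union of its edges. -/
structure Grid (ι ε : Type*) where
  fine : Geometry.SimplicialComplex ℝ Plane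
  finite_faces : fine.faces.Finite
  pure_faces : ∀ s ∈ fine.faces, ∃ T ∈ fine.faces, s ⊆ T ∧ T.card = 3
  /-- the fine triangles of a coarse block -/
  cells : ι → Set (Finset Plane)
  cells_subset : ∀ i, ∀ T ∈ cells i, T ∈ fine.faces ∧ T.card = 3
  cells_partition : ∀ T ∈ fine.faces, T.card = 3 → ∃! i, T ∈ cells i
  block_connected : ∀ i, IsConnected (⋃ T ∈ cells i, convexHull ℝ (T : Set Plane))
  /-- the end points of a coarse edge -/
  src : ε → Plane
  tgt : ε → Plane
  src_ne_tgt : ∀ e, src e ≠ tgt e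
  /-- the block from which the fixed normal of the edge points outwards -/
  plus : ε → ι
  /-- the block on the other side, if there is one -/
  minus : ε → Option ι
  plus_ne_minus : ∀ e, minus e ≠ some (plus e)
  frontier_block : ∀ i, frontier (⋃ T ∈ cells i, convexHull ℝ (T : Set Plane)) =
    ⋃ e ∈ {e | plus e = i ∨ minus e = some i}, segment ℝ (src e) (tgt e)
  boundary_edge : ∀ e, minus e = none → segment ℝ (src e) (tgt e) ⊆ frontier fine.space
  edges_inter : ∀ e e', e ≠ e' →
    (segment ℝ (src e) (tgt e) ∩ segment ℝ (src e') (tgt e')).Subsingleton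

namespace Grid

section

variable {ι ε : Type*} (G : Grid ι ε)

/-- The closure of the computational domain. -/
def domain : Set Plane := G.fine.space

/-- The closed coarse block `K_i`. -/
def block (i : ι) : Set Plane := ⋃ T ∈ G.cells i, convexHull ℝ (T : Set Plane)

/-- The coarse edge `E`. -/
def edge (e : ε) : Set Plane := segment ℝ (G.src e) (G.tgt e)

/-- `E ⊆ ∂K_i`. -/
def Adj (e : ε) (i : ι) : Prop := G.plus e = i ∨ G.minus e = some i

/-- The fine mesh size `h`. -/
def fineSize : ℝ := sSup {d | ∃ T ∈ G.fine.faces, d = Metric.diam (convexHull ℝ (T : Set Plane))}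

/-- The coarse mesh size `H`. -/
def coarseSize : ℝ := ⨆ i, Metric.diam (G.block i)

/-- `N_E`, the maximal number of edges of a coarse block. -/
def maxEdges : ℕ := ⨆ i, Nat.card {e : ε // G.Adj e i}

/-- Integral over `∂K_i` with respect to arc length. -/
def bdryIntegral (i : ι) (g : Plane → ℝ) : ℝ :=
  ∫ x in frontier (G.block i), g x ∂(μH[1] : Measure Plane)

/-- Integral over a coarse edge with respect to arc length. -/
def edgeIntegral (e : ε) (g : Plane → ℝ) : ℝ :=
  ∫ x in G.edge e, g x ∂(μH[1] : Measure Plane)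

/-- The conforming piecewise linear finite element space `V_h(K_i)`; its elements are extended by
zero outside of `K_i`. -/
def localSpace (i : ι) : Submodule ℝ (Plane → ℝ) where
  carrier := {v | ContinuousOn v (G.block i) ∧ (∀ x ∉ G.block i, v x = 0) ∧
    ∀ T ∈ G.cells i, ∃ A : Plane →ᵃ[ℝ] ℝ, Set.EqOn v A (convexHull ℝ (T : Set Plane))}
  add_mem' := by
    rintro v w ⟨hv, hv0, hvA⟩ ⟨hw, hw0, hwA⟩
    refine ⟨hv.add hw, fun x hx => by simp [hv0 x hx, hw0 x hx], fun T hT => ?_⟩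
    obtain ⟨A, hA⟩ := hvA T hT
    obtain ⟨B, hB⟩ := hwA T hT
    exact ⟨A + B, fun x hx => by simp [hA hx, hB hx]⟩
  zero_mem' := ⟨continuousOn_const, fun _ _ => rfl, fun _ _ => ⟨0, fun _ _ => rfl⟩⟩
  smul_mem' := by
    rintro c v ⟨hv, hv0, hvA⟩
    refine ⟨hv.const_smul c, fun x hx => by simp [hv0 x hx], fun T hT => ?_⟩
    obtain ⟨A, hA⟩ := hvA T hT
    exact ⟨c • A, fun x hx => by simp [hA hx]⟩

/-- `V_h^0(K_i)`, which is the second snapshot space. -/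
def bubbleSpace (i : ι) : Submodule ℝ (Plane → ℝ) where
  carrier := {v | v ∈ G.localSpace i ∧ ∀ x ∈ frontier (G.block i), v x = 0}
  add_mem' := fun {v w} hv hw =>
    ⟨add_mem hv.1 hw.1, fun x hx => by simp [hv.2 x hx, hw.2 x hx]⟩
  zero_mem' := ⟨zero_mem _, fun _ _ => rfl⟩
  smul_mem' := fun c v hv => ⟨Submodule.smul_mem _ c hv.1, fun x hx => by simp [hv.2 x hx]⟩

/-- `V_h(∂K_i)`, the restrictions to `∂K_i` of the elements of `V_h(K_i)`. -/
def traceSpace (i : ι) : Set (Plane → ℝ) :=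
  {q | ∃ v ∈ G.localSpace i, q = (frontier (G.block i)).indicator v}

/-- The fine scale space `V^h_DG`: families of functions, one on each coarse block. -/
def brokenSpace : Submodule ℝ (ι → Plane → ℝ) := Submodule.pi Set.univ G.localSpace

variable (κ : Plane → ℝ)

/-- `∫_{K_i} κ ∇u · ∇v`; the gradient of a piecewise linear function exists almost everywhere. -/
def stiffness (i : ι) (u v : Plane → ℝ) : ℝ :=
  ∫ x in G.block i, κ x * inner ℝ (gradient u x) (gradient v x)

/-- The first snapshot space: the span of the discrete harmonic functions on `K_i`. -/
def harmonicSpace (i : ι) : Submodule ℝ (Plane → ℝ) :=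
  Submodule.span ℝ
    {v | v ∈ G.localSpace i ∧ ∀ w ∈ G.bubbleSpace i, G.stiffness κ i v w = 0}

/-- The snapshot space `V_j^{i,snap}`; an index `J = (i, 0)` stands for `j = 1` and `J = (i, 1)`
stands for `j = 2`. -/
def snap (J : ι × Fin 2) : Submodule ℝ (Plane → ℝ) :=
  if J.2 = 0 then G.harmonicSpace κ J.1 else G.bubbleSpace J.1

/-- `κ_K`, the maximum of `κ` over the block. -/
def kmax (i : ι) : ℝ := sSup (κ '' G.block i)

/-- The average of `κ_K` over the blocks adjacent to an edge. -/
def kbar (e : ε) : ℝ :=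
  (G.minus e).elim (G.kmax κ (G.plus e)) fun j => (G.kmax κ (G.plus e) + G.kmax κ j) / 2

/-- The maximum of `kbar` over the edges of a block. -/
def ktilde (i : ι) : ℝ := ⨆ e : {e : ε // G.Adj e i}, G.kbar κ e

/-- `C_inv`: the smallest constant in the inverse inequality
`∫_K κ|∇v|² ≤ κ_K C² h⁻¹ ∫_{∂K} v²` for discrete harmonic functions. -/
def invConst : ℝ := sInf {C | 0 ≤ C ∧ ∀ i, ∀ v ∈ G.harmonicSpace κ i,
  G.stiffness κ i v v ≤ G.kmax κ i * C ^ 2 * G.fineSize⁻¹ * G.bdryIntegral i fun x => v x ^ 2}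

/-- The outward normal flux `κ ∇u · n` on `∂K_i`: the element `q` of `V_h(∂K_i)` with
`∫_{∂K_i} q v = ∫_{K_i} κ ∇u · ∇v` for all discrete harmonic `v`. -/
def flux (i : ι) (u : Plane → ℝ) : Plane → ℝ :=
  Classical.epsilon fun q => q ∈ G.traceSpace i ∧
    ∀ v ∈ G.harmonicSpace κ i, G.bdryIntegral i (fun x => q x * v x) = G.stiffness κ i u v

/-- The jump of a broken function across an edge. -/
def jump (e : ε) (v : ι → Plane → ℝ) (x : Plane) : ℝ :=
  (G.minus e).elim (v (G.plus e) x) fun j => v (G.plus e) x - v j x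

/-- The average of `κ ∇u · n_E` on an edge.  As `n_E` is the inward normal of the block
`minus e`, the outward flux of that block enters with a minus sign. -/
def avgFlux (e : ε) (u : ι → Plane → ℝ) (x : Plane) : ℝ :=
  (G.minus e).elim (G.flux κ (G.plus e) (u (G.plus e)) x) fun j =>
    (G.flux κ (G.plus e) (u (G.plus e)) x - G.flux κ j (u j) x) / 2

variable [Fintype ι] [Fintype ε] (γ : ℝ)

/-- The interior penalty form `a_DG`. -/
def aDG (u v : ι → Plane → ℝ) : ℝ :=
  ∑ i, G.stiffness κ i (u i) (v i)
    - ∑ e, G.edgeIntegral e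
        (fun x => G.avgFlux κ e u x * G.jump e v x + G.avgFlux κ e v x * G.jump e u x)
    + ∑ e, γ / G.fineSize * G.edgeIntegral e (fun x => G.kbar κ e * G.jump e u x * G.jump e v x)

/-- The squared energy norm `‖v‖_a² = a_DG(v, v)`. -/
def energySq (v : ι → Plane → ℝ) : ℝ := G.aDG κ γ v v

/-- `(f, v)`. -/
def load (f : Plane → ℝ) (v : ι → Plane → ℝ) : ℝ := ∑ i, ∫ x in G.block i, f x * v i x

/-- `u` solves the discrete problem in the space `V`. -/
def IsGalerkin (f : Plane → ℝ) (V : Submodule ℝ (ι → Plane → ℝ)) (u : ι → Plane → ℝ) : Prop :=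
  u ∈ V ∧ ∀ v ∈ V, G.aDG κ γ u v = G.load f v

/-- The coercivity constant `a₀ = 1 - C_inv γ^{-1/2}`. -/
def a0 : ℝ := 1 - G.invConst κ / √γ

/-- The continuity constant `a₁ = 1 + C_inv γ^{-1/2}`. -/
def a1 : ℝ := 1 + G.invConst κ / √γ

/-- The constant `C_err` of the a posteriori error estimate. -/
def errConst : ℝ := (G.a0 κ γ)⁻¹

/-- The inner product of the norm `‖·‖_{V_j(K_i)}`, that is `H⁻¹ ∫_{∂K_i} κ̃ v w` for `j = 1` and
`H⁻² ∫_{K_i} κ v w` for `j = 2`. -/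
def mass (J : ι × Fin 2) (v w : Plane → ℝ) : ℝ :=
  if J.2 = 0 then G.coarseSize⁻¹ * G.bdryIntegral J.1 fun x => G.ktilde κ J.1 * v x * w x
  else (G.coarseSize ^ 2)⁻¹ * ∫ x in G.block J.1, κ x * v x * w x

/-- Complete systems of eigenpairs of the local spectral problems
`∫_{K_i} κ ∇φ · ∇v = λ (φ, v)_{V_j(K_i)}` for all `v` in the snapshot space, with the eigenvalues in
nondecreasing order and counted with multiplicity. -/
structure Spectrum where
  dim : ι × Fin 2 → ℕ
  val : ∀ J, Fin (dim J) → ℝ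
  vec : ∀ J, Fin (dim J) → Plane → ℝ
  linearIndependent : ∀ J, LinearIndependent ℝ (vec J)
  span_vec : ∀ J, Submodule.span ℝ (Set.range (vec J)) = G.snap κ J
  eigen : ∀ J k, ∀ v ∈ G.snap κ J,
    G.stiffness κ J.1 (vec J k) v = val J k * G.mass κ J (vec J k) v
  orthogonal : ∀ J k k', k ≠ k' → G.mass κ J (vec J k) (vec J k') = 0
  monotone : ∀ J, Monotone (val J)

end

end Grid

section

variable {ι ε : Type*} [Fintype ι] [Fintype ε] {G : Grid ι ε} {κ : Plane → ℝ}
  (Φ : G.Spectrum κ)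

namespace Grid.Spectrum

/-- `(λ_{j,l+1}^{(i)})⁻¹`, with the convention `λ_{j,l+1}^{(i)} = ∞` if there are only `l`
eigenvalues. -/
def invVal (J : ι × Fin 2) (l : ℕ) : ℝ := if hl : l < Φ.dim J then (Φ.val J ⟨l, hl⟩)⁻¹ else 0

/-- `Λ_{j,i}`, the largest eigenvalue. -/
def maxVal (J : ι × Fin 2) : ℝ := ⨆ k, Φ.val J k

/-- The local offline space spanned by the first `l` eigenfunctions. -/
def localOff (J : ι × Fin 2) (l : ℕ) : Submodule ℝ (Plane → ℝ) :=
  Submodule.span ℝ (Φ.vec J '' {k | (k : ℕ) < l})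

/-- The global offline space for the numbers `l` of eigenfunctions. -/
def off (l : ι × Fin 2 → ℕ) : Submodule ℝ (ι → Plane → ℝ) :=
  Submodule.pi Set.univ fun i => Φ.localOff (i, 0) (l (i, 0)) ⊔ Φ.localOff (i, 1) (l (i, 1))

/-- The projection `P_{j,i}` of the snapshot space onto the local offline space. -/
def proj (J : ι × Fin 2) (l : ℕ) (v : Plane → ℝ) : Plane → ℝ :=
  Classical.epsilon fun p => p ∈ Φ.localOff J l ∧
    ∀ w ∈ Φ.localOff J l, G.mass κ J p w = G.mass κ J v w

variable [DecidableEq ι] (γ : ℝ) (f : Plane → ℝ)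

/-- The residual `R_{j,i}(v) = ∫_{K_i} f v - a_DG(u_H, v)`, where `v` is extended by zero. -/
def residual (_Φ : G.Spectrum κ) (u : ι → Plane → ℝ) (J : ι × Fin 2) (v : Plane → ℝ) : ℝ :=
  (∫ x in G.block J.1, f x * v x) - G.aDG κ γ u (Pi.single J.1 v)

/-- `‖R_{j,i}‖`, the supremum of `|R_{j,i}(v)| / ‖v‖_{V_j(K_i)}` over the snapshot space. -/
def residualNorm (u : ι → Plane → ℝ) (J : ι × Fin 2) : ℝ :=
  ⨆ v : G.snap κ J, |Φ.residual γ f u J v| / √(G.mass κ J v v)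

/-- The squared indicator `η_{j,i}² = ‖R_{j,i}‖² (λ_{j,l+1}^{(i)})⁻¹`. -/
def etaSq (l : ι × Fin 2 → ℕ) (u : ι → Plane → ℝ) (J : ι × Fin 2) : ℝ :=
  Φ.residualNorm γ f u J ^ 2 * Φ.invVal J (l J)

/-- `S_{j,i} = (λ_{j,l+1}^{(i)})^{-1/2} sup_v |R_{j,i}(v - P_{j,i} v)| / ‖v‖_{V_j(K_i)}`. -/
def S (l : ι × Fin 2 → ℕ) (u : ι → Plane → ℝ) (J : ι × Fin 2) : ℝ :=
  √(Φ.invVal J (l J)) *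
    ⨆ v : G.snap κ J, |Φ.residual γ f u J (v - Φ.proj J (l J) v)| / √(G.mass κ J v v)

/-- A run of the adaptive enrichment algorithm with marking parameter `θ` and enrichment ratio
`δ`: `l m` are the numbers of eigenfunctions at level `m`, `u m` is the Galerkin solution and
`I m` is the set of marked indices.  Any marking and any number of new eigenfunctions that meet the
criteria are allowed, in particular the smallest ones. -/
structure IsAdaptiveRun (θ δ : ℝ) (l : ℕ → ι × Fin 2 → ℕ) (I : ℕ → Finset (ι × Fin 2))
    (u : ℕ → ι → Plane → ℝ) : Prop where
  level_le : ∀ m J, l m J ≤ Φ.dim J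
  one_le : ∀ i, 1 ≤ l 0 (i, 0)
  solve : ∀ m, G.IsGalerkin κ γ f (Φ.off (l m)) (u m)
  mark : ∀ m, θ ^ 2 * ∑ J, Φ.etaSq γ f (l m) (u m) J ≤ ∑ J ∈ I m, Φ.etaSq γ f (l m) (u m) J
  unmarked : ∀ m, ∀ J ∉ I m, l (m + 1) J = l m J
  enrich : ∀ m, ∀ J ∈ I m, l m J ≤ l (m + 1) J ∧
    Φ.invVal J (l (m + 1) J) ≤ δ * Φ.invVal J (l m J)

/-- `max_J D_J` with `D_J = (Λ_J + γ H / h) / λ_{J,l+1}`. -/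
def maxD (l : ι × Fin 2 → ℕ) : ℝ :=
  ⨆ J, (Φ.maxVal J + γ * G.coarseSize / G.fineSize) * Φ.invVal J (l J)

/-- The level dependent constant `N_E (1 + α⁻¹) a₁ max_J D_J`. -/
def levelConst (α : ℝ) (l : ι × Fin 2 → ℕ) : ℝ :=
  G.maxEdges * (1 + α⁻¹) * G.a1 κ γ * Φ.maxD γ l

end Grid.Spectrum

end

/-- `ρ = (1 + α) (1 - (1 - δ) θ²)`. -/
def rho (α θ δ : ℝ) : ℝ := (1 + α) * (1 - (1 - δ) * θ ^ 2)

/-- The contraction factor at level `m`. -/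
def contr (θ C δ ρ : ℝ) (L : ℕ → ℝ) (m : ℕ) : ℝ :=
  1 - θ ^ 2 * (1 - ρ * L m / L (m + 1)) / (θ ^ 2 + C * δ * L m)

/-- Constants `L_m` that are positive, dominate the level constants of the run, `c_m ≤ δ L_m`, and
satisfy `ρ L_m < L_{m+1}`. -/
def Admissible (δ ρ : ℝ) (c L : ℕ → ℝ) : Prop :=
  ∀ m, 0 < L m ∧ c m ≤ δ * L m ∧ ρ * L m < L (m + 1)

end GMsDG

end

/-!
The proof has three layers.

*Discretization.* On every block the stiffness form is positive definite on the bubble space,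
because a piecewise linear function without energy is constant on a connected block, and the
boundary form is positive definite on the discrete harmonic functions. The given eigenbases
therefore are orthogonal bases, with positive norms and with positive eigenvalues except possibly
for the first boundary eigenvalue. They yield the splitting of `V_h(K_i)` into harmonic functions
and bubbles (`exists_harmonic_add_bubble`), the existence of the smallest constant of the inverse
inequality (`invConst_spec`) and the flux as a Riesz representative (`flux_spec`). Young's
inequality on the edges turns the inverse inequality into `a₀ E(v) ≤ a_DG(v, v) ≤ a₁ E(v)`, where
`E` is the sum of the stiffness and the penalty (`consistency_le`, `a0_mul_stiffness_le`,
`energySq_le`).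

*Residuals.* By Galerkin orthogonality the residual `R_J` vanishes on the local offline space.
Hence `S_J = η_J` (`S_sq_eq`), and an expansion in eigenfunctions gives
`|R_J(v)| ≤ η_J (∫ κ |∇v|²)^{1/2}`; together with coercivity this is the a posteriori estimate
`energySq_error_le`. The squared dual norm of a functional is an explicit sum over the eigenbasis,
`dualSq`.

*Adaptivity.* Let `d` be the update from one level to the next. Then `R_J` changes by
`a_DG(d, ·)`, whose weighted dual norms are bounded by the energy of `d`, as one sees by testing
with the weighted sum of the local Riesz representatives (`sum_dualSq_le`). The jumps of that sum
cost a factor `2`, which is at most `N_E` since the boundary of a block does not lie on a line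
(`two_le_card_adj`). With the marking this gives the estimator reduction `sum_etaSq_succ_le`, with
the factor `ρ` and with an excess `c_{m+1}` times the energy of `d`. The offline spaces are
nested, so the error loses exactly the energy of `d` (`pythagoras`), which absorbs the excess. The
contraction follows by elementary algebra (`contraction_of_estimator_reduction`). As there are
finitely many eigenvalues, the level constants are bounded, a constant `L` is admissible, and the
contraction factor is then uniform, so the error tends to zero.
-/

noncomputable section

namespace GMsDG

/-! ### Geometry of the blocks -/

namespace Grid
section Geometry

variable {ι ε : Type*} (G : Grid ι ε)

lemma finite_cells (i : ι) : (G.cells i).Finite :=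
  G.finite_faces.subset fun T hT => (G.cells_subset i T hT).1

lemma isCompact_hull (T : Finset Plane) : IsCompact (convexHull ℝ (T : Set Plane)) :=
  T.finite_toSet.isCompact_convexHull ℝ

lemma isCompact_block (i : ι) : IsCompact (G.block i) :=
  (G.finite_cells i).isCompact_biUnion fun T _ => isCompact_hull T

lemma block_subset_domain (i : ι) : G.block i ⊆ G.domain := by
  intro x hx
  obtain ⟨T, hT, hx⟩ := Set.mem_iUnion₂.1 hx
  exact Set.mem_iUnion₂.2 ⟨T, (G.cells_subset i T hT).1, hx⟩

lemma frontier_subset_block (i : ι) : frontier (G.block i) ⊆ G.block i :=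
  (G.isCompact_block i).isClosed.frontier_subset

lemma hull_subset_block {i : ι} {T : Finset Plane} (hT : T ∈ G.cells i) :
    convexHull ℝ (T : Set Plane) ⊆ G.block i :=
  fun _ hx => Set.mem_iUnion₂.2 ⟨T, hT, hx⟩

lemma interior_hull_nonempty {T : Finset Plane} (hT : T ∈ G.fine.faces) (h3 : T.card = 3) :
    (interior (convexHull ℝ (T : Set Plane))).Nonempty := by
  rw [interior_convexHull_nonempty_iff_affineSpan_eq_top]
  have h := (G.fine.indep hT).affineSpan_eq_top_iff_card_eq_finrank_add_one
  rw [Subtype.range_coe_subtype] at h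
  exact h.2 (by simp [h3])

lemma exists_cell (i : ι) : ∃ T, T ∈ G.cells i := by
  obtain ⟨x, hx⟩ := (G.block_connected i).nonempty
  obtain ⟨T, hT, -⟩ := Set.mem_iUnion₂.1 hx
  exact ⟨T, hT⟩

lemma interior_block_nonempty (i : ι) : (interior (G.block i)).Nonempty := by
  obtain ⟨T, hT⟩ := G.exists_cell i
  obtain ⟨hf, h3⟩ := G.cells_subset i T hT
  exact (G.interior_hull_nonempty hf h3).mono (interior_mono (G.hull_subset_block hT))

/-- The open set of interior points of the fine triangles of a block, where the elements of
`V_h(K_i)` are locally affine. -/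
def innerPart (i : ι) : Set Plane := ⋃ T ∈ G.cells i, interior (convexHull ℝ (T : Set Plane))

lemma ae_mem_innerPart (i : ι) : ∀ᵐ x ∂(volume.restrict (G.block i)), x ∈ G.innerPart i := by
  rw [ae_restrict_iff' (G.isCompact_block i).measurableSet]
  have h0 : volume (⋃ T ∈ G.cells i, frontier (convexHull ℝ (T : Set Plane))) = 0 :=
    (measure_biUnion_null_iff (G.finite_cells i).countable).2 fun T _ =>
      (convex_convexHull ℝ _).addHaar_frontier volume
  filter_upwards [measure_eq_zero_iff_ae_notMem.1 h0] with x hx hxb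
  obtain ⟨T, hT, hxT⟩ := Set.mem_iUnion₂.1 hxb
  refine Set.mem_iUnion₂.2 ⟨T, hT, ?_⟩
  by_contra hc
  refine hx (Set.mem_iUnion₂.2 ⟨T, hT, ?_⟩)
  rw [(isCompact_hull T).isClosed.frontier_eq]
  exact ⟨hxT, hc⟩

/-- A linear functional that is constant on the frontier of a block vanishes: it attains its extreme
values over the block on the frontier, so it would be constant on the block. -/
lemma frontier_block_not_subset (i : ι) (ℓ : Plane →L[ℝ] ℝ) (hℓ : ℓ ≠ 0) (c : ℝ) :
    ¬ frontier (G.block i) ⊆ {x | ℓ x = c} := by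
  intro hsub
  have hK := G.isCompact_block i
  have hopen : IsOpenMap ℓ := ℓ.isOpenMap (LinearMap.surjective (f := (ℓ : Plane →ₗ[ℝ] ℝ))
    (fun h => hℓ (ContinuousLinearMap.coe_injective h)))
  -- an extreme value of `ℓ` over the block is not attained at an interior point
  have hext : ∀ y ∈ G.block i, (∀ x ∈ G.block i, ℓ x ≤ ℓ y) ∨ (∀ x ∈ G.block i, ℓ y ≤ ℓ x) →
      ℓ y = c := by
    intro y hy hmax
    apply hsub
    rw [hK.isClosed.frontier_eq]
    refine ⟨hy, fun hyi => ?_⟩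
    have himg : ℓ '' interior (G.block i) ∈ 𝓝 (ℓ y) :=
      (hopen _ isOpen_interior).mem_nhds ⟨y, hyi, rfl⟩
    obtain ⟨r, hr, hball⟩ := Metric.mem_nhds_iff.1 himg
    rcases hmax with h | h
    · obtain ⟨x, hx, hxe⟩ := hball (show ℓ y + r / 2 ∈ Metric.ball (ℓ y) r by
        simp [abs_of_pos hr, hr])
      have := h x (interior_subset hx)
      linarith
    · obtain ⟨x, hx, hxe⟩ := hball (show ℓ y - r / 2 ∈ Metric.ball (ℓ y) r by
        simp [abs_of_pos hr, hr])
      have := h x (interior_subset hx)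
      linarith
  obtain ⟨y, hy, hymax⟩ := hK.exists_isMaxOn (G.block_connected i).nonempty
    ℓ.continuous.continuousOn
  obtain ⟨z, hz, hzmin⟩ := hK.exists_isMinOn (G.block_connected i).nonempty
    ℓ.continuous.continuousOn
  have hyc := hext y hy (Or.inl fun x hx => hymax hx)
  have hzc := hext z hz (Or.inr fun x hx => hzmin hx)
  obtain ⟨x, hx⟩ := G.interior_block_nonempty i
  have hxc : ∀ x ∈ G.block i, ℓ x = c := fun x hx =>
    le_antisymm (hyc ▸ hymax hx) (hzc ▸ hzmin hx)
  have himg : ℓ '' interior (G.block i) ∈ 𝓝 (ℓ x) :=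
    (hopen _ isOpen_interior).mem_nhds ⟨x, hx, rfl⟩
  obtain ⟨r, hr, hball⟩ := Metric.mem_nhds_iff.1 himg
  obtain ⟨x', hx', hxe⟩ := hball (show ℓ x + r / 2 ∈ Metric.ball (ℓ x) r by
    simp [abs_of_pos hr, hr])
  rw [hxc x' (interior_subset hx'), hxc x (interior_subset hx)] at hxe
  linarith

lemma exists_functional_const (a b : Plane) :
    ∃ ℓ : Plane →L[ℝ] ℝ, ℓ ≠ 0 ∧ ∀ x ∈ segment ℝ a b, ℓ x = ℓ a := by
  -- a nonzero vector orthogonal to `b - a`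
  have hdim : Module.finrank ℝ (Submodule.span ℝ {b - a}) < Module.finrank ℝ Plane := by
    have h1 := finrank_span_le_card (R := ℝ) ({b - a} : Set Plane)
    simp only [Set.toFinset_singleton, Finset.card_singleton] at h1
    have h2 : Module.finrank ℝ Plane = 2 := by simp
    omega
  have hne : (Submodule.span ℝ {b - a})ᗮ ≠ ⊥ := by
    intro h
    rw [Submodule.orthogonal_eq_bot_iff] at h
    rw [h, finrank_top] at hdim
    exact lt_irrefl _ hdim
  obtain ⟨n, hn, hn0⟩ := Submodule.exists_mem_ne_zero_of_ne_bot hne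
  refine ⟨innerSL ℝ n, fun h => hn0 ?_, ?_⟩
  · have := congrArg (fun g : Plane →L[ℝ] ℝ => g n) h
    simpa using this
  · rintro x hx
    rw [segment_eq_image'] at hx
    obtain ⟨t, -, rfl⟩ := hx
    have h0 : inner ℝ n (b - a) = 0 :=
      (Submodule.mem_orthogonal' _ _).1 hn _ (Submodule.mem_span_singleton_self _)
    simp only [map_add, map_smul, innerSL_apply_apply, h0, smul_zero, add_zero]

lemma edge_subset_frontier {e : ε} {i : ι} (h : G.Adj e i) : G.edge e ⊆ frontier (G.block i) := by
  intro x hx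
  rw [block, G.frontier_block i]
  exact Set.mem_iUnion₂.2 ⟨e, h, hx⟩

lemma frontier_eq_iUnion (i : ι) :
    frontier (G.block i) = ⋃ e : {e : ε // G.Adj e i}, G.edge e := by
  rw [block, G.frontier_block i]
  ext x
  simp [edge, Adj]

/-- The boundary of a block does not lie on a line, so a single edge cannot cover it. -/
lemma two_le_card_adj [Finite ε] (i : ι) : 2 ≤ Nat.card {e : ε // G.Adj e i} := by
  by_contra hlt
  have hsub : Subsingleton {e : ε // G.Adj e i} := by
    rw [← Finite.card_le_one_iff_subsingleton]; omega
  rcases isEmpty_or_nonempty {e : ε // G.Adj e i} with hemp | ⟨⟨e⟩⟩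
  · obtain ⟨ℓ, hℓ, -⟩ := exists_functional_const 0 0
    refine G.frontier_block_not_subset i ℓ hℓ 0 ?_
    rw [G.frontier_eq_iUnion]
    simp
  · obtain ⟨ℓ, hℓ, hc⟩ := exists_functional_const (G.src e) (G.tgt e)
    refine G.frontier_block_not_subset i ℓ hℓ (ℓ (G.src e)) ?_
    rw [G.frontier_eq_iUnion]
    refine Set.iUnion_subset fun e' => ?_
    rw [Subsingleton.elim e' e]
    exact hc

lemma exists_adj [Finite ε] (i : ι) : ∃ e, G.Adj e i := by
  have h := G.two_le_card_adj i
  have : Nonempty {e : ε // G.Adj e i} := (Nat.card_pos_iff.1 (by omega)).1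
  exact ⟨this.some.1, this.some.2⟩

lemma two_le_maxEdges [Nonempty ι] [Finite ι] [Finite ε] : 2 ≤ G.maxEdges :=
  (G.two_le_card_adj (Classical.arbitrary ι)).trans
    (le_ciSup (f := fun i => Nat.card {e : ε // G.Adj e i}) (Set.finite_range _).bddAbove _)

lemma coarseSize_pos [Nonempty ι] [Finite ι] : 0 < G.coarseSize := by
  obtain ⟨T, hT⟩ := G.exists_cell (Classical.arbitrary ι)
  refine lt_of_lt_of_le ?_ (le_ciSup (f := fun i => Metric.diam (G.block i))
    (Set.finite_range _).bddAbove (Classical.arbitrary ι))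
  refine Metric.diam_pos ?_ (G.isCompact_block _).isBounded
  have h3 := (G.cells_subset _ T hT).2
  obtain ⟨x, hx, y, hy, hxy⟩ := Finset.one_lt_card.1 (show 1 < T.card by omega)
  exact ⟨x, G.hull_subset_block hT (subset_convexHull ℝ _ hx), y,
    G.hull_subset_block hT (subset_convexHull ℝ _ hy), hxy⟩

lemma fineSize_pos [Nonempty ι] : 0 < G.fineSize := by
  obtain ⟨T, hT⟩ := G.exists_cell (Classical.arbitrary ι)
  obtain ⟨hf, h3⟩ := G.cells_subset _ T hT
  have hfin : {d | ∃ T ∈ G.fine.faces, d = Metric.diam (convexHull ℝ (T : Set Plane))}.Finite :=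
    (G.finite_faces.image fun T : Finset Plane => Metric.diam (convexHull ℝ (T : Set Plane))).subset
      (by rintro d ⟨T', hT', rfl⟩; exact Set.mem_image_of_mem _ hT')
  refine lt_of_lt_of_le ?_ (le_csSup hfin.bddAbove ⟨T, hf, rfl⟩)
  refine Metric.diam_pos ?_ (isCompact_hull T).isBounded
  obtain ⟨x, hx, y, hy, hxy⟩ := Finset.one_lt_card.1 (show 1 < T.card by omega)
  exact ⟨x, subset_convexHull ℝ _ hx, y, subset_convexHull ℝ _ hy, hxy⟩

/-! ### Arc length integrals -/

instance : NullSingletonClass (μH[1] : Measure Plane) :=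
  Measure.nullSingletonClass_hausdorff _ one_pos

lemma isCompact_edge (e : ε) : IsCompact (G.edge e) := by
  have : G.edge e = convexHull ℝ {G.src e, G.tgt e} := (convexHull_pair _ _).symm
  rw [this]
  exact (Set.toFinite _).isCompact_convexHull ℝ

instance (e : ε) : IsFiniteMeasure ((μH[1] : Measure Plane).restrict (G.edge e)) :=
  ⟨by rw [Measure.restrict_apply_univ, edge, hausdorffMeasure_segment]; exact edist_lt_top _ _⟩

instance [Finite ε] (i : ι) :
    IsFiniteMeasure ((μH[1] : Measure Plane).restrict (frontier (G.block i))) := by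
  refine ⟨?_⟩
  rw [Measure.restrict_apply_univ, G.frontier_eq_iUnion]
  cases nonempty_fintype {e : ε // G.Adj e i}
  refine (measure_iUnion_fintype_le _ _).trans_lt (ENNReal.sum_lt_top.2 fun e _ => ?_)
  rw [edge, hausdorffMeasure_segment]; exact edist_lt_top _ _

lemma integrableOn_of_continuousOn {μ : Measure Plane} {K : Set Plane} (hK : IsCompact K)
    [IsFiniteMeasure (μ.restrict K)] {g : Plane → ℝ} (hg : ContinuousOn g K) :
    IntegrableOn g K μ := by
  obtain ⟨C, hC⟩ := hK.exists_bound_of_continuousOn hg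
  exact Integrable.of_bound (hg.aestronglyMeasurable hK.measurableSet) C
    ((ae_restrict_iff' hK.measurableSet).2 (ae_of_all _ hC))

lemma isCompact_frontier (i : ι) : IsCompact (frontier (G.block i)) :=
  (G.isCompact_block i).of_isClosed_subset isClosed_frontier (G.frontier_subset_block i)

open Classical in
lemma bdryIntegral_eq_sum [Fintype ε] (i : ι) {g : Plane → ℝ}
    (hg : ContinuousOn g (frontier (G.block i))) :
    G.bdryIntegral i g = ∑ e ∈ Finset.univ.filter (G.Adj · i), G.edgeIntegral e g := by
  have hint : IntegrableOn g (frontier (G.block i)) μH[1] :=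
    integrableOn_of_continuousOn (G.isCompact_frontier i) hg
  rw [bdryIntegral]
  rw [G.frontier_eq_iUnion] at hint ⊢
  rw [integral_iUnion_ae (s := fun e : {e : ε // G.Adj e i} => G.edge e)
      (fun e => (G.isCompact_edge e).measurableSet.nullMeasurableSet) ?_ hint,
    tsum_fintype, Finset.sum_subtype (p := fun e => G.Adj e i)]
  · rfl
  · simp
  · intro e e' hne
    exact (G.edges_inter e e' fun h => hne (Subtype.ext h)).measure_zero _

/-- A continuous function whose square integrates to zero over an edge vanishes on it, as every
subsegment has positive length. -/
lemma eqOn_zero_of_edgeIntegral_sq {e : ε} {g : Plane → ℝ} (hg : ContinuousOn g (G.edge e))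
    (h : G.edgeIntegral e (fun x => g x ^ 2) = 0) : ∀ x ∈ G.edge e, g x = 0 := by
  have hint : IntegrableOn (fun x => g x ^ 2) (G.edge e) μH[1] :=
    integrableOn_of_continuousOn (G.isCompact_edge e) (hg.pow 2)
  have h0 := (setIntegral_eq_zero_iff_of_nonneg_ae (ae_of_all _ fun x => sq_nonneg (g x)) hint).1 h
  have hnull : (μH[1] : Measure Plane) {x | x ∈ G.edge e ∧ g x ≠ 0} = 0 := by
    rw [EventuallyEq, ae_restrict_iff' (G.isCompact_edge e).measurableSet] at h0
    refine measure_mono_null (fun x hx => ?_) (ae_iff.1 h0)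
    simpa using hx
  -- parametrize the edge
  let p : ℝ → Plane := fun t => AffineMap.lineMap (G.src e) (G.tgt e) t
  have hp : Continuous p := AffineMap.lineMap_continuous
  have hmaps : ∀ t ∈ Set.Icc (0 : ℝ) 1, p t ∈ G.edge e := fun t ht => by
    rw [edge, segment_eq_image_lineMap]; exact ⟨t, ht, rfl⟩
  have hpc : ContinuousOn (g ∘ p) (Set.Icc 0 1) := hg.comp hp.continuousOn hmaps
  -- between two parameters there is a zero of `g`
  have hdense : ∀ s ∈ Set.Icc (0 : ℝ) 1, ∀ t ∈ Set.Icc (0 : ℝ) 1, s < t →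
      ∃ r ∈ Set.Icc s t, g (p r) = 0 := by
    intro s hs t ht hst
    by_contra! hne
    have hsub : segment ℝ (p s) (p t) ⊆ {x | x ∈ G.edge e ∧ g x ≠ 0} := by
      intro x hx
      rw [segment_eq_image_lineMap] at hx
      obtain ⟨r, hr, rfl⟩ := hx
      have hpr : AffineMap.lineMap (p s) (p t) r = p (AffineMap.lineMap s t r) := by
        simp only [p]
        rw [← AffineMap.apply_lineMap]
      have hmem : AffineMap.lineMap s t r ∈ Set.Icc s t := by
        rw [← segment_eq_Icc hst.le, segment_eq_image_lineMap]; exact ⟨r, hr, rfl⟩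
      rw [hpr]
      exact ⟨hmaps _ ⟨hs.1.trans hmem.1, hmem.2.trans ht.2⟩, hne _ hmem⟩
    have := measure_mono_null hsub hnull
    rw [hausdorffMeasure_segment, edist_eq_zero] at this
    exact hst.ne (AffineMap.lineMap_injective ℝ (G.src_ne_tgt e) this)
  intro x hx
  rw [edge, segment_eq_image_lineMap] at hx
  obtain ⟨t, ht, rfl⟩ := hx
  have hcl : t ∈ closure ({r | g (p r) = 0} ∩ Set.Icc 0 1) := by
    rw [Metric.mem_closure_iff]
    intro η hη
    rcases ht.2.lt_or_eq with hlt | heq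
    · obtain ⟨r, hr, hr0⟩ := hdense t ht (min 1 (t + η / 2))
        ⟨le_min zero_le_one (by linarith [ht.1]), min_le_left _ _⟩ (lt_min hlt (by linarith))
      have h1 := hr.2.trans (min_le_right _ _)
      refine ⟨r, ⟨hr0, ht.1.trans hr.1, hr.2.trans (min_le_left _ _)⟩, ?_⟩
      rw [dist_comm, Real.dist_eq, abs_of_nonneg (by linarith [hr.1])]
      linarith
    · obtain ⟨r, hr, hr0⟩ := hdense (max 0 (t - η / 2))
        ⟨le_max_left _ _, max_le zero_le_one (by linarith [ht.2])⟩ t ht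
        (max_lt (by linarith) (by linarith))
      have h1 := (le_max_right _ _).trans hr.1
      refine ⟨r, ⟨hr0, (le_max_left _ _).trans hr.1, hr.2.trans ht.2⟩, ?_⟩
      rw [Real.dist_eq, abs_of_nonneg (by linarith [hr.2])]
      linarith
  have hcw : ContinuousWithinAt (g ∘ p) ({r | g (p r) = 0} ∩ Set.Icc 0 1) t :=
    (hpc t ht).mono Set.inter_subset_right
  have := hcw.mem_closure_image hcl
  have hsub : (g ∘ p) '' ({r | g (p r) = 0} ∩ Set.Icc 0 1) ⊆ {0} := by
    rintro _ ⟨r, hr, rfl⟩; exact hr.1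
  simpa using closure_minimal hsub isClosed_singleton this

lemma edgeIntegral_nonneg (e : ε) {g : Plane → ℝ} (hg : ∀ x, 0 ≤ g x) : 0 ≤ G.edgeIntegral e g :=
  integral_nonneg hg

lemma bdryIntegral_nonneg (i : ι) {g : Plane → ℝ} (hg : ∀ x, 0 ≤ g x) : 0 ≤ G.bdryIntegral i g :=
  integral_nonneg hg

lemma eqOn_zero_of_bdryIntegral_sq [Finite ε] {i : ι} {g : Plane → ℝ}
    (hg : ContinuousOn g (frontier (G.block i)))
    (h : G.bdryIntegral i (fun x => g x ^ 2) = 0) : ∀ x ∈ frontier (G.block i), g x = 0 := by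
  classical
  cases nonempty_fintype ε
  rw [G.bdryIntegral_eq_sum i (g := fun x => g x ^ 2) (hg.pow 2),
    Finset.sum_eq_zero_iff_of_nonneg fun e _ => G.edgeIntegral_nonneg e fun x => sq_nonneg _] at h
  intro x hx
  rw [G.frontier_eq_iUnion] at hx
  obtain ⟨e, hxe⟩ := Set.mem_iUnion.1 hx
  exact G.eqOn_zero_of_edgeIntegral_sq (hg.mono (G.edge_subset_frontier e.2))
    (h e (by simpa using e.2)) x hxe

end Geometry
end Grid

/-! ### Local forms on the finite element spaces -/

namespace Grid
section Forms

variable {ι ε : Type*} (G : Grid ι ε)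

/-- The standing assumptions on the coefficient: measurable, at least one and bounded. -/
structure IsCoefficient (κ : Plane → ℝ) : Prop where
  measurable : Measurable κ
  one_le : ∀ x ∈ G.domain, 1 ≤ κ x
  bddAbove : BddAbove (κ '' G.domain)

variable {G}

lemma hasFDerivAt_of_eqOn_affine {v : Plane → ℝ} {x : Plane} {T : Finset Plane}
    (hx : x ∈ interior (convexHull ℝ (T : Set Plane)))
    {A : Plane →ᵃ[ℝ] ℝ} (hA : Set.EqOn v A (convexHull ℝ (T : Set Plane))) :
    HasFDerivAt v (LinearMap.toContinuousLinearMap A.linear) x := by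
  have h1 : HasFDerivAt A (LinearMap.toContinuousLinearMap A.linear) x := by
    have hA' : (A : Plane → ℝ) = fun y => LinearMap.toContinuousLinearMap A.linear y + A 0 :=
      A.decomp
    rw [hA']
    exact (LinearMap.toContinuousLinearMap A.linear).hasFDerivAt.add_const (A 0)
  exact h1.congr_of_eventuallyEq
    (mem_of_superset (mem_interior_iff_mem_nhds.1 hx) fun y hy => hA hy)

lemma localSpace_differentiableAt {i : ι} {v : Plane → ℝ} (hv : v ∈ G.localSpace i) {x : Plane}
    (hx : x ∈ G.innerPart i) : DifferentiableAt ℝ v x := by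
  obtain ⟨T, hT, hx⟩ := Set.mem_iUnion₂.1 hx
  obtain ⟨A, hA⟩ := hv.2.2 T hT
  exact (hasFDerivAt_of_eqOn_affine hx hA).differentiableAt

lemma localSpace_exists_gradient_bound {i : ι} {v : Plane → ℝ} (hv : v ∈ G.localSpace i) :
    ∃ M, ∀ x ∈ G.innerPart i, ‖gradient v x‖ ≤ M := by
  choose! A hA using hv.2.2
  obtain ⟨M, hM⟩ := ((G.finite_cells i).image
    fun T => ‖LinearMap.toContinuousLinearMap (A T).linear‖).bddAbove
  refine ⟨M, fun x hx => ?_⟩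
  obtain ⟨T, hT, hx⟩ := Set.mem_iUnion₂.1 hx
  rw [gradient, (hasFDerivAt_of_eqOn_affine hx (hA T hT)).fderiv, LinearIsometryEquiv.norm_map]
  exact hM ⟨T, hT, rfl⟩

lemma measurable_gradient (v : Plane → ℝ) : Measurable (gradient v) :=
  (InnerProductSpace.toDual ℝ Plane).symm.continuous.measurable.comp (measurable_fderiv ℝ v)

variable {κ : Plane → ℝ}

lemma IsCoefficient.one_le_block (hκ : G.IsCoefficient κ) {i : ι} {x : Plane}
    (hx : x ∈ G.block i) : 1 ≤ κ x := hκ.one_le x (G.block_subset_domain i hx)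

lemma IsCoefficient.exists_bound (hκ : G.IsCoefficient κ) :
    ∃ M, ∀ x ∈ G.domain, ‖κ x‖ ≤ M := by
  obtain ⟨M, hM⟩ := hκ.bddAbove
  refine ⟨M, fun x hx => ?_⟩
  rw [Real.norm_of_nonneg (zero_le_one.trans (hκ.one_le x hx))]
  exact hM ⟨x, hx, rfl⟩

instance (i : ι) : IsFiniteMeasure ((volume : Measure Plane).restrict (G.block i)) :=
  ⟨by rw [Measure.restrict_apply_univ]; exact (G.isCompact_block i).measure_lt_top⟩

lemma IsCoefficient.integrableOn_stiffness (hκ : G.IsCoefficient κ) {i : ι} {u v : Plane → ℝ}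
    (hu : u ∈ G.localSpace i) (hv : v ∈ G.localSpace i) :
    IntegrableOn (fun x => κ x * inner ℝ (gradient u x) (gradient v x)) (G.block i) := by
  obtain ⟨K, hK⟩ := hκ.exists_bound
  obtain ⟨M, hM⟩ := localSpace_exists_gradient_bound hu
  obtain ⟨N, hN⟩ := localSpace_exists_gradient_bound hv
  refine Integrable.of_bound (hκ.measurable.mul
    ((measurable_gradient u).inner (measurable_gradient v))).aestronglyMeasurable (K * (M * N)) ?_
  filter_upwards [G.ae_mem_innerPart i, ae_restrict_mem (G.isCompact_block i).measurableSet]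
    with x hx hxb
  have hK' := hK x (G.block_subset_domain i hxb)
  rw [norm_mul]
  refine mul_le_mul hK' ((norm_inner_le_norm _ _).trans ?_) (norm_nonneg _)
    ((norm_nonneg _).trans hK')
  exact mul_le_mul (hM x hx) (hN x hx) (norm_nonneg _) ((norm_nonneg _).trans (hM x hx))

lemma stiffness_comm (i : ι) (u v : Plane → ℝ) : G.stiffness κ i u v = G.stiffness κ i v u := by
  simp only [stiffness, real_inner_comm]

lemma IsCoefficient.stiffness_add_left (hκ : G.IsCoefficient κ) {i : ι} {u u' v : Plane → ℝ}
    (hu : u ∈ G.localSpace i) (hu' : u' ∈ G.localSpace i) (hv : v ∈ G.localSpace i) :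
    G.stiffness κ i (u + u') v = G.stiffness κ i u v + G.stiffness κ i u' v := by
  rw [stiffness, stiffness, stiffness,
    ← integral_add (hκ.integrableOn_stiffness hu hv) (hκ.integrableOn_stiffness hu' hv)]
  refine integral_congr_ae ?_
  filter_upwards [G.ae_mem_innerPart i] with x hx
  rw [gradient, fderiv_add (localSpace_differentiableAt hu hx) (localSpace_differentiableAt hu' hx),
    map_add, inner_add_left, mul_add]
  rfl

lemma stiffness_smul_left {i : ι} {u : Plane → ℝ} (c : ℝ) (hu : u ∈ G.localSpace i)
    (v : Plane → ℝ) : G.stiffness κ i (c • u) v = c * G.stiffness κ i u v := by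
  rw [stiffness, stiffness, ← integral_const_mul]
  refine integral_congr_ae ?_
  filter_upwards [G.ae_mem_innerPart i] with x hx
  rw [gradient, fderiv_const_smul (localSpace_differentiableAt hu hx), map_smulₛₗ,
    real_inner_smul_left]
  simp only [gradient, conj_trivial]
  ring

/-- The stiffness form `∫_{K_i} κ ∇u · ∇v` on `V_h(K_i)`. -/
def IsCoefficient.stiffForm (hκ : G.IsCoefficient κ) (i : ι) :
    LinearMap.BilinForm ℝ (G.localSpace i) :=
  LinearMap.mk₂ ℝ (fun u v => G.stiffness κ i u v)
    (fun u u' v => hκ.stiffness_add_left u.2 u'.2 v.2)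
    (fun c u v => stiffness_smul_left c u.2 v)
    (fun u v v' => by
      simp only [stiffness_comm i (u : Plane → ℝ)]
      exact hκ.stiffness_add_left v.2 v'.2 u.2)
    (fun c u v => by
      simp only [stiffness_comm i (u : Plane → ℝ)]
      exact stiffness_smul_left c v.2 u)

lemma IsCoefficient.stiffForm_apply (hκ : G.IsCoefficient κ) {i : ι} (u v : G.localSpace i) :
    hκ.stiffForm i u v = G.stiffness κ i u v := rfl

lemma IsCoefficient.stiffness_self_nonneg (hκ : G.IsCoefficient κ) (i : ι) (v : Plane → ℝ) :
    0 ≤ G.stiffness κ i v v :=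
  setIntegral_nonneg (G.isCompact_block i).measurableSet fun _ hx =>
    mul_nonneg (zero_le_one.trans (hκ.one_le_block hx)) real_inner_self_nonneg

/-- A piecewise linear function without energy is constant on the block: it is constant on every
fine triangle, so it has finitely many values, and the block is connected. -/
lemma IsCoefficient.exists_eq_const (hκ : G.IsCoefficient κ) {i : ι} {v : Plane → ℝ}
    (hv : v ∈ G.localSpace i) (h : G.stiffness κ i v v = 0) : ∃ c, ∀ x ∈ G.block i, v x = c := by
  have hmeas := (G.isCompact_block i).measurableSet
  have h0 := (setIntegral_eq_zero_iff_of_nonneg_ae ((ae_restrict_iff' hmeas).2 (ae_of_all _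
    fun _ hx => mul_nonneg (zero_le_one.trans (hκ.one_le_block hx)) real_inner_self_nonneg))
    (hκ.integrableOn_stiffness hv hv)).1 h
  rw [EventuallyEq, ae_restrict_iff' hmeas] at h0
  have hconst : ∀ T ∈ G.cells i, ∃ c, ∀ x ∈ convexHull ℝ (T : Set Plane), v x = c := by
    intro T hT
    obtain ⟨A, hA⟩ := hv.2.2 T hT
    obtain ⟨hf, h3⟩ := G.cells_subset i T hT
    have hne := G.interior_hull_nonempty hf h3
    -- a null set does not contain the interior of the triangle
    obtain ⟨x, hx, hx0⟩ : ∃ x ∈ interior (convexHull ℝ (T : Set Plane)), gradient v x = 0 := by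
      by_contra! hcon
      refine (isOpen_interior.measure_pos volume hne).ne' (measure_mono_null ?_ (ae_iff.1 h0))
      intro x hx hz
      have hxb := G.hull_subset_block hT (interior_subset hx)
      rcases mul_eq_zero.1 (hz hxb) with h | h
      · have := hκ.one_le_block hxb
        linarith
      · exact hcon x hx (inner_self_eq_zero.1 h)
    have hlin : A.linear = 0 := by
      rw [gradient, LinearIsometryEquiv.map_eq_zero_iff,
        (hasFDerivAt_of_eqOn_affine hx hA).fderiv] at hx0
      exact LinearMap.toContinuousLinearMap.map_eq_zero_iff.1 hx0
    obtain ⟨c, hc⟩ := A.linear_eq_zero_iff_exists_const.1 hlin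
    exact ⟨c, fun x hx => by rw [hA hx, hc]; rfl⟩
  choose! c hc using hconst
  have hfin : (v '' G.block i).Finite := by
    refine ((G.finite_cells i).image c).subset ?_
    rintro _ ⟨x, hx, rfl⟩
    obtain ⟨T, hT, hx⟩ := Set.mem_iUnion₂.1 hx
    exact ⟨T, hT, (hc T hT x hx).symm⟩
  have hsub : (v '' G.block i).Subsingleton := by
    by_contra hns
    have hpre := (G.block_connected i).isPreconnected.image v hv.1
    exact hpre.infinite_of_nontrivial (Set.not_subsingleton_iff.1 hns) hfin
  obtain ⟨x, hx⟩ := (G.block_connected i).nonempty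
  exact ⟨v x, fun y hy => hsub ⟨y, hy, rfl⟩ ⟨x, hx, rfl⟩⟩

lemma bubbleSpace_le (i : ι) : G.bubbleSpace i ≤ G.localSpace i := fun _ h => h.1

lemma frontier_nonempty [Finite ε] (i : ι) : (frontier (G.block i)).Nonempty := by
  obtain ⟨e, he⟩ := G.exists_adj i
  exact ⟨_, G.edge_subset_frontier he (left_mem_segment ℝ _ _)⟩

lemma IsCoefficient.bubble_eq_zero [Finite ε] (hκ : G.IsCoefficient κ) {i : ι} {v : Plane → ℝ}
    (hv : v ∈ G.bubbleSpace i) (h : G.stiffness κ i v v = 0) : v = 0 := by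
  obtain ⟨c, hc⟩ := hκ.exists_eq_const hv.1 h
  obtain ⟨y, hy⟩ := frontier_nonempty (G := G) i
  have hc0 : c = 0 := by rw [← hc y (G.frontier_subset_block i hy), hv.2 y hy]
  funext x
  by_cases hx : x ∈ G.block i
  · rw [hc x hx, hc0]; rfl
  · exact hv.1.2.1 x hx

lemma IsCoefficient.mem_harmonicSpace (hκ : G.IsCoefficient κ) {i : ι} {v : Plane → ℝ} :
    v ∈ G.harmonicSpace κ i ↔
      v ∈ G.localSpace i ∧ ∀ w ∈ G.bubbleSpace i, G.stiffness κ i v w = 0 := by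
  refine ⟨fun h => ?_, fun h => Submodule.subset_span h⟩
  induction h using Submodule.span_induction with
  | mem x hx => exact hx
  | zero =>
    refine ⟨zero_mem _, fun w hw => ?_⟩
    have := stiffness_smul_left (κ := κ) 0 (zero_mem (G.localSpace i)) w
    simpa using this
  | add x y _ _ hx hy =>
    refine ⟨add_mem hx.1 hy.1, fun w hw => ?_⟩
    rw [hκ.stiffness_add_left hx.1 hy.1 hw.1, hx.2 w hw, hy.2 w hw, add_zero]
  | smul c x _ hx =>
    refine ⟨Submodule.smul_mem _ c hx.1, fun w hw => ?_⟩
    rw [stiffness_smul_left c hx.1, hx.2 w hw, mul_zero]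

lemma IsCoefficient.harmonicSpace_le (hκ : G.IsCoefficient κ) (i : ι) :
    G.harmonicSpace κ i ≤ G.localSpace i := fun _ h => (hκ.mem_harmonicSpace.1 h).1

lemma IsCoefficient.snap_le (hκ : G.IsCoefficient κ) (J : ι × Fin 2) :
    G.snap κ J ≤ G.localSpace J.1 := by
  unfold snap
  split_ifs
  exacts [hκ.harmonicSpace_le J.1, bubbleSpace_le J.1]

lemma continuousOn_frontier {i : ι} {v : Plane → ℝ} (hv : v ∈ G.localSpace i) :
    ContinuousOn v (frontier (G.block i)) := hv.1.mono (G.frontier_subset_block i)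

lemma IsCoefficient.harmonic_eq_zero [Finite ε] (hκ : G.IsCoefficient κ) {i : ι} {v : Plane → ℝ}
    (hv : v ∈ G.harmonicSpace κ i) (h : G.bdryIntegral i (fun x => v x ^ 2) = 0) : v = 0 := by
  obtain ⟨hl, ho⟩ := hκ.mem_harmonicSpace.1 hv
  have hb : v ∈ G.bubbleSpace i :=
    ⟨hl, G.eqOn_zero_of_bdryIntegral_sq (continuousOn_frontier hl) h⟩
  exact hκ.bubble_eq_zero hb (ho v hb)

/-- The boundary form `∫_{∂K_i} v w` on `V_h(K_i)`. -/
def bdryForm [Finite ε] (i : ι) : LinearMap.BilinForm ℝ (G.localSpace i) :=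
  have hint : ∀ u v : G.localSpace i, IntegrableOn (fun x => (u : Plane → ℝ) x * (v : Plane → ℝ) x)
      (frontier (G.block i)) μH[1] := fun u v =>
    integrableOn_of_continuousOn (G.isCompact_frontier i)
      ((continuousOn_frontier u.2).mul (continuousOn_frontier v.2))
  LinearMap.mk₂ ℝ (fun u v => G.bdryIntegral i fun x => (u : Plane → ℝ) x * (v : Plane → ℝ) x)
    (fun u u' v => by
      simp only [bdryIntegral]
      rw [← integral_add (hint u v) (hint u' v)]
      exact integral_congr_ae (ae_of_all _ fun x => by simp [add_mul]))
    (fun c u v => by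
      simp only [bdryIntegral, smul_eq_mul]
      rw [← integral_const_mul]
      exact integral_congr_ae (ae_of_all _ fun x => by simp [mul_assoc]))
    (fun u v v' => by
      simp only [bdryIntegral]
      rw [← integral_add (hint u v) (hint u v')]
      exact integral_congr_ae (ae_of_all _ fun x => by simp [mul_add]))
    (fun c u v => by
      simp only [bdryIntegral, smul_eq_mul]
      rw [← integral_const_mul]
      exact integral_congr_ae (ae_of_all _ fun x => by simp [mul_left_comm]))

lemma IsCoefficient.integrableOn_weight (hκ : G.IsCoefficient κ) {i : ι} {u v : Plane → ℝ}
    (hu : u ∈ G.localSpace i) (hv : v ∈ G.localSpace i) :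
    IntegrableOn (fun x => κ x * u x * v x) (G.block i) := by
  obtain ⟨K, hK⟩ := hκ.exists_bound
  have h1 : IntegrableOn (fun x => u x * v x) (G.block i) :=
    (hu.1.mul hv.1).integrableOn_compact (G.isCompact_block i)
  refine (Integrable.bdd_mul (c := K) h1 hκ.measurable.aestronglyMeasurable ?_).congr
    (ae_of_all _ fun x => by simp [mul_assoc])
  filter_upwards [ae_restrict_mem (G.isCompact_block i).measurableSet] with x hx
  exact hK x (G.block_subset_domain i hx)

/-- The weighted form `∫_{K_i} κ v w` on `V_h(K_i)`. -/
def IsCoefficient.weightForm (hκ : G.IsCoefficient κ) (i : ι) :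
    LinearMap.BilinForm ℝ (G.localSpace i) :=
  LinearMap.mk₂ ℝ (fun u v => ∫ x in G.block i, κ x * (u : Plane → ℝ) x * (v : Plane → ℝ) x)
    (fun u u' v => by
      rw [← integral_add (hκ.integrableOn_weight u.2 v.2) (hκ.integrableOn_weight u'.2 v.2)]
      exact integral_congr_ae (ae_of_all _ fun x => by simp [add_mul, mul_add]))
    (fun c u v => by
      rw [smul_eq_mul, ← integral_const_mul]
      exact integral_congr_ae (ae_of_all _ fun x => by simp; ring))
    (fun u v v' => by
      rw [← integral_add (hκ.integrableOn_weight u.2 v.2) (hκ.integrableOn_weight u.2 v'.2)]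
      exact integral_congr_ae (ae_of_all _ fun x => by simp [mul_add]))
    (fun c u v => by
      rw [smul_eq_mul, ← integral_const_mul]
      exact integral_congr_ae (ae_of_all _ fun x => by simp; ring))

lemma IsCoefficient.one_le_kmax (hκ : G.IsCoefficient κ) (i : ι) : 1 ≤ G.kmax κ i := by
  obtain ⟨x, hx⟩ := (G.block_connected i).nonempty
  exact (hκ.one_le_block hx).trans
    (le_csSup (hκ.bddAbove.mono (Set.image_mono (G.block_subset_domain i))) ⟨x, hx, rfl⟩)

lemma IsCoefficient.one_le_kbar (hκ : G.IsCoefficient κ) (e : ε) : 1 ≤ G.kbar κ e := by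
  unfold kbar
  have h1 := hκ.one_le_kmax (G.plus e)
  rcases G.minus e with _ | j
  · exact h1
  · have h2 := hκ.one_le_kmax j
    simp only [Option.elim]
    linarith

lemma kbar_le_ktilde [Finite ε] {e : ε} {i : ι} (h : G.Adj e i) : G.kbar κ e ≤ G.ktilde κ i :=
  le_ciSup (f := fun e : {e : ε // G.Adj e i} => G.kbar κ e) (Set.finite_range _).bddAbove ⟨e, h⟩

lemma IsCoefficient.one_le_ktilde [Finite ε] (hκ : G.IsCoefficient κ) (i : ι) :
    1 ≤ G.ktilde κ i := by
  obtain ⟨e, he⟩ := G.exists_adj i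
  exact (hκ.one_le_kbar e).trans (kbar_le_ktilde he)

/-- The form of the norm `‖·‖_{V_j(K_i)}`, on all of `V_h(K_i)`. -/
def IsCoefficient.massForm [Finite ε] (hκ : G.IsCoefficient κ) (J : ι × Fin 2) :
    LinearMap.BilinForm ℝ (G.localSpace J.1) :=
  if J.2 = 0 then (G.coarseSize⁻¹ * G.ktilde κ J.1) • bdryForm J.1
  else (G.coarseSize ^ 2)⁻¹ • hκ.weightForm J.1

lemma mass_zero (i : ι) (u v : Plane → ℝ) :
    G.mass κ (i, 0) u v =
      G.coarseSize⁻¹ * G.ktilde κ i * G.bdryIntegral i fun x => u x * v x := by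
  simp only [mass, if_pos, mul_assoc, bdryIntegral, integral_const_mul]

lemma IsCoefficient.massForm_apply [Finite ε] (hκ : G.IsCoefficient κ) {J : ι × Fin 2}
    (u v : G.localSpace J.1) : hκ.massForm J u v = G.mass κ J u v := by
  obtain ⟨i, j⟩ := J
  by_cases hj : j = 0
  · subst hj
    rw [mass_zero, massForm, if_pos rfl]
    rfl
  · rw [mass, massForm, if_neg hj, if_neg hj]
    rfl

lemma IsCoefficient.mass_self_nonneg [Finite ι] [Finite ε] (hκ : G.IsCoefficient κ)
    (J : ι × Fin 2) (v : Plane → ℝ) : 0 ≤ G.mass κ J v v := by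
  have : Nonempty ι := ⟨J.1⟩
  have hH := G.coarseSize_pos
  have hk := hκ.one_le_ktilde J.1
  unfold mass
  split_ifs
  · refine mul_nonneg (inv_nonneg.2 hH.le) (G.bdryIntegral_nonneg _ fun x => ?_)
    rw [mul_assoc]
    exact mul_nonneg (by linarith) (mul_self_nonneg _)
  · refine mul_nonneg (by positivity) (setIntegral_nonneg (G.isCompact_block _).measurableSet
      fun x hx => ?_)
    rw [mul_assoc]
    exact mul_nonneg (zero_le_one.trans (hκ.one_le_block hx)) (mul_self_nonneg _)

end Forms
end Grid

/-! ### Eigenbases of the local spectral problems -/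

namespace Grid

section Spectrum

variable {ι ε : Type*} {G : Grid ι ε} {κ : Plane → ℝ}

lemma sum_bilin_of_orthogonal {V : Type*} [AddCommGroup V] [Module ℝ V]
    (b : LinearMap.BilinForm ℝ V) {n : ℕ} (φ : Fin n → V) (h : ∀ k k', k ≠ k' → b (φ k) (φ k') = 0)
    (c d : Fin n → ℝ) :
    b (∑ k, c k • φ k) (∑ k, d k • φ k) = ∑ k, c k * d k * b (φ k) (φ k) := by
  simp only [map_sum, LinearMap.sum_apply, map_smul, LinearMap.smul_apply, smul_eq_mul]
  refine Finset.sum_congr rfl fun k _ => ?_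
  rw [Finset.sum_eq_single k]
  · ring
  · intro k' _ hk'
    rw [h k' k hk']; ring
  · simp

namespace Spectrum

variable (Φ : G.Spectrum κ)

/-- The linear combination of the eigenfunctions with given coefficients. -/
def comb (J : ι × Fin 2) (c : Fin (Φ.dim J) → ℝ) : Plane → ℝ := ∑ k, c k • Φ.vec J k

lemma vec_mem (J : ι × Fin 2) (k : Fin (Φ.dim J)) : Φ.vec J k ∈ G.snap κ J := by
  rw [← Φ.span_vec J]; exact Submodule.subset_span ⟨k, rfl⟩

lemma comb_mem (J : ι × Fin 2) (c : Fin (Φ.dim J) → ℝ) : Φ.comb J c ∈ G.snap κ J :=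
  sum_mem fun k _ => Submodule.smul_mem _ _ (Φ.vec_mem J k)

lemma exists_comb {J : ι × Fin 2} {v : Plane → ℝ} (hv : v ∈ G.snap κ J) :
    ∃ c, v = Φ.comb J c := by
  rw [← Φ.span_vec J, Submodule.mem_span_range_iff_exists_fun] at hv
  obtain ⟨c, hc⟩ := hv
  exact ⟨c, hc.symm⟩

lemma comb_single {J : ι × Fin 2} (k : Fin (Φ.dim J)) :
    Φ.comb J (Pi.single k 1) = Φ.vec J k := by
  simp [comb, Pi.single_apply]

lemma vec_ne_zero (J : ι × Fin 2) (k : Fin (Φ.dim J)) : Φ.vec J k ≠ 0 :=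
  (Φ.linearIndependent J).ne_zero k

/-- An eigenfunction as an element of `V_h(K_i)`. -/
def vecL (hκ : G.IsCoefficient κ) (Φ : G.Spectrum κ) (J : ι × Fin 2) (k : Fin (Φ.dim J)) :
    G.localSpace J.1 := ⟨Φ.vec J k, hκ.snap_le J (Φ.vec_mem J k)⟩

variable [Fintype ι] [Fintype ε] {Φ} (hκ : G.IsCoefficient κ)
include hκ

omit [Fintype ι] [Fintype ε] in
lemma coe_sum_vecL (J : ι × Fin 2) (c : Fin (Φ.dim J) → ℝ) :
    ((∑ k, c k • vecL hκ Φ J k : G.localSpace J.1) : Plane → ℝ) = Φ.comb J c := by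
  simp [comb, vecL]

omit [Fintype ι] [Fintype ε] hκ in
lemma stiffness_vec_of_ne {J : ι × Fin 2} {k k' : Fin (Φ.dim J)} (h : k ≠ k') :
    G.stiffness κ J.1 (Φ.vec J k) (Φ.vec J k') = 0 := by
  rw [Φ.eigen J k _ (Φ.vec_mem J k'), Φ.orthogonal J k k' h, mul_zero]

omit [Fintype ι] in
lemma mass_comb (J : ι × Fin 2) (c d : Fin (Φ.dim J) → ℝ) :
    G.mass κ J (Φ.comb J c) (Φ.comb J d) =
      ∑ k, c k * d k * G.mass κ J (Φ.vec J k) (Φ.vec J k) := by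
  rw [← coe_sum_vecL hκ, ← coe_sum_vecL hκ, ← hκ.massForm_apply,
    sum_bilin_of_orthogonal _ _ fun k k' h => by
      rw [hκ.massForm_apply]; exact Φ.orthogonal J k k' h]
  simp only [hκ.massForm_apply]
  rfl

omit [Fintype ι] [Fintype ε] in
lemma stiffness_comb (J : ι × Fin 2) (c d : Fin (Φ.dim J) → ℝ) :
    G.stiffness κ J.1 (Φ.comb J c) (Φ.comb J d) =
      ∑ k, c k * d k * (Φ.val J k * G.mass κ J (Φ.vec J k) (Φ.vec J k)) := by
  rw [← coe_sum_vecL hκ, ← coe_sum_vecL hκ, ← hκ.stiffForm_apply,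
    sum_bilin_of_orthogonal _ _ fun k k' h => stiffness_vec_of_ne h]
  refine Finset.sum_congr rfl fun k _ => ?_
  rw [← Φ.eigen J k _ (Φ.vec_mem J k)]
  rfl

omit [Fintype ι] in
lemma stiffness_vec_bubble_pos {i : ι} (k : Fin (Φ.dim (i, 1))) :
    0 < G.stiffness κ i (Φ.vec (i, 1) k) (Φ.vec (i, 1) k) :=
  lt_of_le_of_ne (hκ.stiffness_self_nonneg i _) fun h =>
    Φ.vec_ne_zero (i, 1) k (hκ.bubble_eq_zero (Φ.vec_mem (i, 1) k) h.symm)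

omit [Fintype ι] in
lemma bdryIntegral_vec_pos {i : ι} (k : Fin (Φ.dim (i, 0))) :
    0 < G.bdryIntegral i fun x => Φ.vec (i, 0) k x ^ 2 :=
  lt_of_le_of_ne (G.bdryIntegral_nonneg i fun _ => sq_nonneg _) fun h =>
    Φ.vec_ne_zero (i, 0) k (hκ.harmonic_eq_zero (Φ.vec_mem (i, 0) k) h.symm)

lemma mass_vec_pos (J : ι × Fin 2) (k : Fin (Φ.dim J)) :
    0 < G.mass κ J (Φ.vec J k) (Φ.vec J k) := by
  obtain ⟨i, j⟩ := J
  have : Nonempty ι := ⟨i⟩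
  match j with
  | 0 =>
    rw [mass_zero]
    have h1 := bdryIntegral_vec_pos hκ k
    simp only [sq] at h1
    have h2 := hκ.one_le_ktilde i
    have h3 := G.coarseSize_pos
    positivity
  | 1 =>
    refine lt_of_le_of_ne (hκ.mass_self_nonneg _ _) fun h => ?_
    have h1 := stiffness_vec_bubble_pos hκ k
    have h2 := Φ.eigen (i, 1) k _ (Φ.vec_mem (i, 1) k)
    rw [← h, mul_zero] at h2
    exact h1.ne' h2

lemma val_nonneg (J : ι × Fin 2) (k : Fin (Φ.dim J)) : 0 ≤ Φ.val J k := by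
  have h1 := hκ.stiffness_self_nonneg J.1 (Φ.vec J k)
  rw [Φ.eigen J k _ (Φ.vec_mem J k)] at h1
  exact nonneg_of_mul_nonneg_left h1 (mass_vec_pos hκ J k)

/-- Only the first eigenvalue of a block boundary problem can vanish, as its eigenfunctions for the
eigenvalue zero are constant. -/
lemma val_pos (J : ι × Fin 2) (k : Fin (Φ.dim J)) (hk : J.2 = 0 → 1 ≤ (k : ℕ)) :
    0 < Φ.val J k := by
  refine lt_of_le_of_ne (val_nonneg hκ J k) fun h => ?_
  have henergy : ∀ k' ≤ k, G.stiffness κ J.1 (Φ.vec J k') (Φ.vec J k') = 0 := by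
    intro k' hk'
    rw [Φ.eigen J k' _ (Φ.vec_mem J k'),
      le_antisymm (h ▸ Φ.monotone J hk') (val_nonneg hκ J k'), zero_mul]
  obtain ⟨i, j⟩ := J
  match j with
  | 1 => exact (stiffness_vec_bubble_pos hκ k).ne' (henergy k le_rfl)
  | 0 =>
    have hk1 := hk rfl
    let k0 : Fin (Φ.dim (i, 0)) := ⟨0, by have := k.2; omega⟩
    have hne : k0 ≠ k := fun h => by rw [← h] at hk1; simp [k0] at hk1
    have hloc := fun k' => hκ.snap_le (i, 0) (Φ.vec_mem (i, 0) k')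
    obtain ⟨a, ha⟩ := hκ.exists_eq_const (hloc k) (henergy k le_rfl)
    obtain ⟨b, hb⟩ := hκ.exists_eq_const (hloc k0) (henergy k0 (by
      rw [Fin.le_def]; exact Nat.zero_le _))
    -- `b φ_k - a φ_0` vanishes
    have hdep : b • Φ.vec (i, 0) k + (-a) • Φ.vec (i, 0) k0 = 0 := by
      funext x
      by_cases hx : x ∈ G.block i
      · simp [ha x hx, hb x hx]; ring
      · simp [(hloc k).2.1 x hx, (hloc k0).2.1 x hx]
    obtain ⟨hb0, -⟩ := (LinearIndepOn.pair_iff _ hne.symm).1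
      ((Φ.linearIndependent (i, 0)).linearIndepOn _) _ _ hdep
    refine Φ.vec_ne_zero (i, 0) k0 (funext fun x => ?_)
    by_cases hx : x ∈ G.block i
    · simp [hb x hx, hb0]
    · exact (hloc k0).2.1 x hx

lemma mass_comb_nonneg_terms (J : ι × Fin 2) (c : Fin (Φ.dim J) → ℝ) (k : Fin (Φ.dim J)) :
    0 ≤ c k * c k * G.mass κ J (Φ.vec J k) (Φ.vec J k) :=
  mul_nonneg (mul_self_nonneg _) (mass_vec_pos hκ J k).le

lemma stiffness_le_maxVal_mass {J : ι × Fin 2} {v : Plane → ℝ} (hv : v ∈ G.snap κ J) :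
    G.stiffness κ J.1 v v ≤ Φ.maxVal J * G.mass κ J v v := by
  obtain ⟨c, rfl⟩ := Φ.exists_comb hv
  rw [stiffness_comb hκ, mass_comb hκ, Finset.mul_sum]
  refine Finset.sum_le_sum fun k _ => ?_
  have h1 : Φ.val J k ≤ Φ.maxVal J := le_ciSup (Set.finite_range _).bddAbove k
  have h2 := mass_comb_nonneg_terms hκ J c k
  nlinarith

lemma maxVal_nonneg (J : ι × Fin 2) : 0 ≤ Φ.maxVal J :=
  Real.iSup_nonneg fun k => val_nonneg hκ J k

lemma invVal_nonneg (J : ι × Fin 2) (l : ℕ) : 0 ≤ Φ.invVal J l := by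
  unfold invVal
  split_ifs
  · exact inv_nonneg.2 (val_nonneg hκ J _)
  · exact le_rfl

/-- `1 ≤ λ_k / λ_{l+1}` for every index `k` beyond the first `l`. -/
lemma one_le_invVal_mul_val {J : ι × Fin 2} {l : ℕ} (hl : J.2 = 0 → 1 ≤ l) {k : Fin (Φ.dim J)}
    (hk : l ≤ k) : 1 ≤ Φ.invVal J l * Φ.val J k := by
  have hd : l < Φ.dim J := hk.trans_lt k.2
  rw [invVal, dif_pos hd]
  have hpos := val_pos hκ J ⟨l, hd⟩ hl
  rw [inv_mul_eq_div, one_le_div hpos]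
  exact Φ.monotone J (Fin.le_def.2 hk)

lemma invVal_antitone {J : ι × Fin 2} {l l' : ℕ} (hl : J.2 = 0 → 1 ≤ l) (h : l ≤ l') :
    Φ.invVal J l' ≤ Φ.invVal J l := by
  by_cases hd : l' < Φ.dim J
  · have h1 := val_pos hκ J ⟨l, h.trans_lt hd⟩ hl
    rw [invVal, invVal, dif_pos hd, dif_pos (h.trans_lt hd)]
    exact inv_anti₀ h1 (Φ.monotone J (Fin.le_def.2 h))
  · rw [invVal, dif_neg hd]
    exact invVal_nonneg hκ J l

omit [Fintype ι] in
/-- The discrete harmonic and bubble parts of a piecewise linear function. -/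
lemma exists_harmonic_add_bubble (Φ : G.Spectrum κ) {i : ι} {v : Plane → ℝ}
    (hv : v ∈ G.localSpace i) :
    ∃ p ∈ G.harmonicSpace κ i, ∃ b ∈ G.bubbleSpace i, v = p + b := by
  -- the stiffness projection of `v` onto the span of the bubble eigenfunctions
  let c : Fin (Φ.dim (i, 1)) → ℝ := fun k =>
    G.stiffness κ i v (Φ.vec (i, 1) k) / G.stiffness κ i (Φ.vec (i, 1) k) (Φ.vec (i, 1) k)
  have hb : Φ.comb (i, 1) c ∈ G.bubbleSpace i := Φ.comb_mem (i, 1) c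
  refine ⟨v - Φ.comb (i, 1) c, hκ.mem_harmonicSpace.2 ⟨sub_mem hv hb.1, fun w hw => ?_⟩, _, hb,
    (sub_add_cancel _ _).symm⟩
  obtain ⟨d, rfl⟩ := Φ.exists_comb (J := (i, 1)) hw
  have h1 : G.stiffness κ i (v - Φ.comb (i, 1) c) (Φ.comb (i, 1) d) =
      G.stiffness κ i v (Φ.comb (i, 1) d) - G.stiffness κ i (Φ.comb (i, 1) c) (Φ.comb (i, 1) d) :=
    LinearMap.map_sub₂ (hκ.stiffForm i) ⟨v, hv⟩ ⟨_, hb.1⟩ ⟨_, hw.1⟩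
  have h2 : G.stiffness κ i v (Φ.comb (i, 1) d) =
      ∑ k, d k * G.stiffness κ i v (Φ.vec (i, 1) k) := by
    rw [← coe_sum_vecL hκ]
    change hκ.stiffForm i ⟨v, hv⟩ (∑ k, d k • vecL hκ Φ (i, 1) k) = _
    simp only [map_sum, map_smul, smul_eq_mul]
    rfl
  rw [h1, h2, stiffness_comb hκ (i, 1), sub_eq_zero]
  refine Finset.sum_congr rfl fun k _ => ?_
  rw [← Φ.eigen (i, 1) k _ (Φ.vec_mem (i, 1) k)]
  have := (stiffness_vec_bubble_pos hκ k).ne'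
  simp only [c]
  field_simp

end Spectrum

variable [Fintype ι] [Fintype ε]

/-! ### The inverse inequality and the flux -/

/-- The smallest constant of the inverse inequality is attained. -/
lemma IsCoefficient.invConst_spec (hκ : G.IsCoefficient κ) (Φ : G.Spectrum κ) :
    0 ≤ G.invConst κ ∧ ∀ i, ∀ v ∈ G.harmonicSpace κ i, G.stiffness κ i v v ≤
      G.kmax κ i * G.invConst κ ^ 2 * G.fineSize⁻¹ * G.bdryIntegral i fun x => v x ^ 2 := by
  refine IsClosed.csInf_mem (s := {C | 0 ≤ C ∧ ∀ i, ∀ v ∈ G.harmonicSpace κ i,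
    G.stiffness κ i v v ≤
      G.kmax κ i * C ^ 2 * G.fineSize⁻¹ * G.bdryIntegral i fun x => v x ^ 2}) ?_ ?_
    ⟨0, fun C hC => hC.1⟩
  · have hset : {C | 0 ≤ C ∧ ∀ i, ∀ v ∈ G.harmonicSpace κ i, G.stiffness κ i v v ≤
        G.kmax κ i * C ^ 2 * G.fineSize⁻¹ * G.bdryIntegral i fun x => v x ^ 2} =
        Set.Ici 0 ∩ ⋂ i, ⋂ v ∈ G.harmonicSpace κ i, {C | G.stiffness κ i v v ≤
          G.kmax κ i * C ^ 2 * G.fineSize⁻¹ * G.bdryIntegral i fun x => v x ^ 2} := by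
      ext C
      simp
    rw [hset]
    exact isClosed_Ici.inter (isClosed_iInter fun i => isClosed_biInter fun v _ =>
      isClosed_le continuous_const (by fun_prop))
  · -- the eigenvalues provide some constant
    let D : ι → ℝ := fun i =>
      Φ.maxVal (i, 0) * (G.coarseSize⁻¹ * G.ktilde κ i) * G.fineSize
    have hD : ∀ i, 0 ≤ D i := fun i => by
      have : Nonempty ι := ⟨i⟩
      have h1 := Spectrum.maxVal_nonneg (Φ := Φ) hκ (i, 0)
      have h2 := hκ.one_le_ktilde i
      have h3 := G.coarseSize_pos
      have h4 := G.fineSize_pos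
      positivity
    refine ⟨√(∑ i, D i), Real.sqrt_nonneg _, fun i v hv => ?_⟩
    have : Nonempty ι := ⟨i⟩
    have hh := G.fineSize_pos
    have h1 := Spectrum.stiffness_le_maxVal_mass (Φ := Φ) hκ (J := (i, 0)) hv
    rw [mass_zero] at h1
    rw [Real.sq_sqrt (Finset.sum_nonneg fun i _ => hD i)]
    have hb : 0 ≤ G.bdryIntegral i fun x => v x ^ 2 :=
      G.bdryIntegral_nonneg i fun x => sq_nonneg _
    have h2 : D i ≤ G.kmax κ i * ∑ i, D i :=
      (Finset.single_le_sum (fun i _ => hD i) (Finset.mem_univ i)).trans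
        (le_mul_of_one_le_left (Finset.sum_nonneg fun i _ => hD i) (hκ.one_le_kmax i))
    calc G.stiffness κ i v v ≤ D i * G.fineSize⁻¹ * G.bdryIntegral i fun x => v x ^ 2 := by
          refine h1.trans_eq ?_
          simp only [D, sq]
          field_simp
      _ ≤ _ := by gcongr

omit [Fintype ι] [Fintype ε] in
lemma bdryIntegral_congr {i : ι} {g g' : Plane → ℝ}
    (h : ∀ x ∈ frontier (G.block i), g x = g' x) : G.bdryIntegral i g = G.bdryIntegral i g' :=
  setIntegral_congr_fun (G.isCompact_frontier i).measurableSet h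

omit [Fintype ι] in
/-- Two traces with the same moments against the discrete harmonic functions agree, because every
trace, in particular their difference, is the trace of a discrete harmonic function. -/
lemma IsCoefficient.trace_unique (hκ : G.IsCoefficient κ) (Φ : G.Spectrum κ) {i : ι}
    {q r : Plane → ℝ} (hq : q ∈ G.traceSpace i) (hr : r ∈ G.traceSpace i)
    (h : ∀ v ∈ G.harmonicSpace κ i, G.bdryIntegral i (fun x => q x * v x) =
      G.bdryIntegral i fun x => r x * v x) : q = r := by
  obtain ⟨a, ha, rfl⟩ := hq
  obtain ⟨b, hb, rfl⟩ := hr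
  obtain ⟨p, hp, w, hw, hab⟩ := Spectrum.exists_harmonic_add_bubble hκ Φ (sub_mem ha hb)
  have hpab : ∀ x ∈ frontier (G.block i), p x = a x - b x := fun x hx => by
    have := congrFun hab x
    simp only [Pi.sub_apply, Pi.add_apply, hw.2 x hx, add_zero] at this
    exact this.symm
  have hpl := hκ.harmonicSpace_le i hp
  have h0 : G.bdryIntegral i (fun x => p x ^ 2) = 0 := by
    have h1 : bdryForm i ⟨a, ha⟩ ⟨p, hpl⟩ = bdryForm i ⟨b, hb⟩ ⟨p, hpl⟩ := by
      refine Eq.trans (bdryIntegral_congr fun x hx => ?_)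
        ((h p hp).trans (bdryIntegral_congr fun x hx => ?_)) <;> simp [hx]
    have h2 := LinearMap.map_sub₂ (bdryForm (G := G) i) ⟨a, ha⟩ ⟨b, hb⟩ ⟨p, hpl⟩
    rw [h1, sub_self] at h2
    rw [← h2]
    refine bdryIntegral_congr fun x hx => ?_
    simp [hpab x hx, sq]
  have hz := G.eqOn_zero_of_bdryIntegral_sq (continuousOn_frontier hpl) h0
  funext x
  by_cases hx : x ∈ frontier (G.block i)
  · have := hz x hx
    rw [hpab x hx] at this
    simp [hx, sub_eq_zero.1 this]
  · simp [hx]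

/-- The flux is the Riesz representative of the stiffness functional on the traces; the boundary
eigenfunctions form an orthogonal basis of the traces. -/
lemma IsCoefficient.flux_spec (hκ : G.IsCoefficient κ) (Φ : G.Spectrum κ) {i : ι}
    {u : Plane → ℝ} (hu : u ∈ G.localSpace i) :
    G.flux κ i u ∈ G.traceSpace i ∧ ∀ v ∈ G.harmonicSpace κ i,
      G.bdryIntegral i (fun x => G.flux κ i u x * v x) = G.stiffness κ i u v := by
  refine Classical.epsilon_spec (p := fun q => q ∈ G.traceSpace i ∧
    ∀ v ∈ G.harmonicSpace κ i, G.bdryIntegral i (fun x => q x * v x) = G.stiffness κ i u v) ?_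
  let B : LinearMap.BilinForm ℝ (G.localSpace i) := bdryForm i
  let φ := Spectrum.vecL hκ Φ (i, 0)
  have hpos : ∀ k, 0 < B (φ k) (φ k) := fun k => by
    have := Spectrum.bdryIntegral_vec_pos hκ (Φ := Φ) k
    simp only [sq] at this
    exact this
  have horth : ∀ k k', k ≠ k' → B (φ k) (φ k') = 0 := fun k k' hne => by
    have : Nonempty ι := ⟨i⟩
    have h1 := Φ.orthogonal (i, 0) k k' hne
    have h2 := G.coarseSize_pos
    have h3 := hκ.one_le_ktilde i
    rw [mass_zero] at h1
    exact (mul_eq_zero.1 h1).resolve_left (by positivity)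
  let c : Fin (Φ.dim (i, 0)) → ℝ := fun k => hκ.stiffForm i ⟨u, hu⟩ (φ k) / B (φ k) (φ k)
  refine ⟨_, ⟨_, (∑ k, c k • φ k).2, rfl⟩, fun v hv => ?_⟩
  obtain ⟨d, hd⟩ := Φ.exists_comb (J := (i, 0)) hv
  have hv' : (⟨v, hκ.harmonicSpace_le i hv⟩ : G.localSpace i) = ∑ k, d k • φ k :=
    Subtype.ext (hd.trans (Spectrum.coe_sum_vecL hκ (i, 0) d).symm)
  have h1 : B (∑ k, c k • φ k) ⟨v, hκ.harmonicSpace_le i hv⟩ =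
      hκ.stiffForm i ⟨u, hu⟩ ⟨v, hκ.harmonicSpace_le i hv⟩ := by
    rw [hv', sum_bilin_of_orthogonal _ _ horth]
    simp only [map_sum, map_smul, smul_eq_mul]
    refine Finset.sum_congr rfl fun k _ => ?_
    have := (hpos k).ne'
    simp only [c]
    field_simp
  refine Eq.trans (bdryIntegral_congr fun x hx => ?_) h1
  simp [hx]

omit [Fintype ι] [Fintype ε] in
lemma traceSpace_continuousOn {i : ι} {q : Plane → ℝ} (hq : q ∈ G.traceSpace i) :
    ContinuousOn q (frontier (G.block i)) := by
  obtain ⟨a, ha, rfl⟩ := hq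
  exact (continuousOn_frontier ha).congr fun x hx => by simp [hx]

lemma IsCoefficient.flux_add (hκ : G.IsCoefficient κ) (Φ : G.Spectrum κ) {i : ι}
    {u v : Plane → ℝ} (hu : u ∈ G.localSpace i) (hv : v ∈ G.localSpace i) :
    G.flux κ i (u + v) = G.flux κ i u + G.flux κ i v := by
  obtain ⟨h1, h1'⟩ := hκ.flux_spec Φ (add_mem hu hv)
  obtain ⟨h2, h2'⟩ := hκ.flux_spec Φ hu
  obtain ⟨h3, h3'⟩ := hκ.flux_spec Φ hv
  refine hκ.trace_unique Φ h1 ?_ fun w hw => ?_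
  · obtain ⟨a, ha, hae⟩ := h2
    obtain ⟨b, hb, hbe⟩ := h3
    exact ⟨a + b, add_mem ha hb, by rw [hae, hbe, Set.indicator_add']⟩
  · have hwl := hκ.harmonicSpace_le i hw
    have hint : ∀ q ∈ G.traceSpace i, IntegrableOn (fun x => q x * w x) (frontier (G.block i))
        μH[1] := fun q hq => integrableOn_of_continuousOn (G.isCompact_frontier i)
      ((traceSpace_continuousOn hq).mul (continuousOn_frontier hwl))
    rw [h1' w hw, hκ.stiffness_add_left hu hv hwl, ← h2' w hw, ← h3' w hw, bdryIntegral,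
      bdryIntegral, bdryIntegral, ← integral_add (hint _ h2) (hint _ h3)]
    exact integral_congr_ae (ae_of_all _ fun x => by simp [add_mul])

lemma IsCoefficient.flux_smul (hκ : G.IsCoefficient κ) (Φ : G.Spectrum κ) {i : ι} (c : ℝ)
    {u : Plane → ℝ} (hu : u ∈ G.localSpace i) :
    G.flux κ i (c • u) = c • G.flux κ i u := by
  obtain ⟨h1, h1'⟩ := hκ.flux_spec Φ (Submodule.smul_mem _ c hu)
  obtain ⟨h2, h2'⟩ := hκ.flux_spec Φ hu
  refine hκ.trace_unique Φ h1 ?_ fun w hw => ?_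
  · obtain ⟨a, ha, hae⟩ := h2
    exact ⟨c • a, Submodule.smul_mem _ c ha, by
      rw [hae]; exact (Set.indicator_const_smul _ c a).symm⟩
  · rw [h1' w hw, stiffness_smul_left c hu, ← h2' w hw, bdryIntegral, bdryIntegral,
      ← integral_const_mul]
    exact integral_congr_ae (ae_of_all _ fun x => by simp [mul_assoc])

/-- The inverse inequality bounds the flux: test it with the discrete harmonic function that has the
flux as its trace. -/
lemma IsCoefficient.bdryIntegral_flux_sq_le (hκ : G.IsCoefficient κ) (Φ : G.Spectrum κ) {i : ι}
    {u : Plane → ℝ} (hu : u ∈ G.localSpace i) :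
    G.bdryIntegral i (fun x => G.flux κ i u x ^ 2) ≤
      G.kmax κ i * G.invConst κ ^ 2 * G.fineSize⁻¹ * G.stiffness κ i u u := by
  obtain ⟨⟨a, ha, hq⟩, hflux⟩ := hκ.flux_spec Φ hu
  obtain ⟨p, hp, w, hw, hapw⟩ := Spectrum.exists_harmonic_add_bubble hκ Φ ha
  have hqp : ∀ x ∈ frontier (G.block i), G.flux κ i u x = p x := fun x hx => by
    rw [hq, Set.indicator_of_mem hx, hapw, Pi.add_apply, hw.2 x hx, add_zero]
  have hpl := hκ.harmonicSpace_le i hp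
  have h1 : G.bdryIntegral i (fun x => G.flux κ i u x ^ 2) = G.stiffness κ i u p := by
    rw [← hflux p hp]
    exact bdryIntegral_congr fun x hx => by simp only [hqp x hx, sq]
  have h2 : G.bdryIntegral i (fun x => G.flux κ i u x ^ 2) = G.bdryIntegral i fun x => p x ^ 2 :=
    bdryIntegral_congr fun x hx => by simp only [hqp x hx]
  have hcs : G.stiffness κ i u p ^ 2 ≤ G.stiffness κ i u u * G.stiffness κ i p p := by
    have := LinearMap.BilinForm.apply_mul_apply_le_of_forall_zero_le (hκ.stiffForm i)
      (fun v => hκ.stiffness_self_nonneg i v) ⟨u, hu⟩ ⟨p, hpl⟩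
    simp only [hκ.stiffForm_apply] at this
    rwa [stiffness_comm i p u, ← sq] at this
  have hinv := (hκ.invConst_spec Φ).2 i p hp
  have hX : 0 ≤ G.bdryIntegral i (fun x => G.flux κ i u x ^ 2) :=
    G.bdryIntegral_nonneg i fun x => sq_nonneg _
  have hS := hκ.stiffness_self_nonneg i u
  have : Nonempty ι := ⟨i⟩
  have hh := G.fineSize_pos
  have hk := hκ.one_le_kmax i
  have hM : 0 ≤ G.kmax κ i * G.invConst κ ^ 2 * G.fineSize⁻¹ := by positivity
  rw [← h2] at hinv
  rw [← h1] at hcs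
  by_contra hlt
  rw [not_le] at hlt
  have hXpos : 0 < G.bdryIntegral i (fun x => G.flux κ i u x ^ 2) :=
    lt_of_le_of_lt (mul_nonneg hM hS) hlt
  have h3 := mul_le_mul_of_nonneg_left hinv hS
  have h4 := mul_lt_mul_of_pos_right hlt hXpos
  nlinarith

end Spectrum
end Grid

/-! ### The interior penalty form -/

namespace Grid

section DG

variable {ι ε : Type*} {G : Grid ι ε} {κ : Plane → ℝ}

lemma mem_brokenSpace {u : ι → Plane → ℝ} : u ∈ G.brokenSpace ↔ ∀ i, u i ∈ G.localSpace i := by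
  simp [brokenSpace, Submodule.mem_pi]

lemma adj_plus (e : ε) : G.Adj e (G.plus e) := Or.inl rfl

lemma adj_minus {e : ε} {j : ι} (h : G.minus e = some j) : G.Adj e j := Or.inr h

lemma continuousOn_edge {e : ε} {i : ι} (h : G.Adj e i) {v : Plane → ℝ}
    (hv : v ∈ G.localSpace i) : ContinuousOn v (G.edge e) :=
  (continuousOn_frontier hv).mono (G.edge_subset_frontier h)

lemma jump_continuousOn {v : ι → Plane → ℝ} (hv : v ∈ G.brokenSpace) (e : ε) :
    ContinuousOn (G.jump e v) (G.edge e) := by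
  rw [mem_brokenSpace] at hv
  unfold jump
  cases h : G.minus e with
  | none => exact continuousOn_edge (adj_plus e) (hv _)
  | some j =>
    exact (continuousOn_edge (adj_plus e) (hv _)).sub (continuousOn_edge (adj_minus h) (hv j))

lemma jump_add (e : ε) (u v : ι → Plane → ℝ) (x : Plane) :
    G.jump e (u + v) x = G.jump e u x + G.jump e v x := by
  unfold jump
  cases G.minus e with
  | none => rfl
  | some j => simp only [Option.elim, Pi.add_apply]; ring

lemma jump_smul (e : ε) (c : ℝ) (u : ι → Plane → ℝ) (x : Plane) :
    G.jump e (c • u) x = c * G.jump e u x := by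
  unfold jump
  cases G.minus e with
  | none => rfl
  | some j => simp only [Option.elim, Pi.smul_apply, smul_eq_mul]; ring

open Classical in
lemma sum_adj [Fintype ι] (e : ε) (g : ι → ℝ) :
    ∑ i ∈ Finset.univ.filter (G.Adj e), g i =
      (G.minus e).elim (g (G.plus e)) fun j => g (G.plus e) + g j := by
  cases h : G.minus e with
  | none =>
    have : Finset.univ.filter (G.Adj e) = {G.plus e} := by
      ext i; simp [Adj, h, eq_comm]
    rw [this, Finset.sum_singleton]; rfl
  | some j =>
    have hne : G.plus e ≠ j := fun hj => G.plus_ne_minus e (by rw [h, hj])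
    have : Finset.univ.filter (G.Adj e) = {G.plus e, j} := by
      ext i; simp [Adj, h, eq_comm]
    rw [this, Finset.sum_pair hne]; rfl

variable [Fintype ι] [Fintype ε]

open Classical in
/-- Pointwise bounds on the edges by contributions of the adjacent blocks add up to boundary
integrals of the blocks. -/
lemma sum_edgeIntegral_le {F : ε → Plane → ℝ} {g : ι → Plane → ℝ}
    (hF : ∀ e, ContinuousOn (F e) (G.edge e))
    (hg : ∀ i, ContinuousOn (g i) (frontier (G.block i)))
    (h : ∀ e x, F e x ≤ (G.minus e).elim (g (G.plus e) x) fun j => g (G.plus e) x + g j x) :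
    ∑ e, G.edgeIntegral e (F e) ≤ ∑ i, G.bdryIntegral i (g i) := by
  have hint : ∀ e i, G.Adj e i → IntegrableOn (g i) (G.edge e) μH[1] := fun e i hei =>
    integrableOn_of_continuousOn (G.isCompact_edge e) ((hg i).mono (G.edge_subset_frontier hei))
  calc ∑ e, G.edgeIntegral e (F e)
      ≤ ∑ e, ∑ i ∈ Finset.univ.filter (G.Adj e), G.edgeIntegral e (g i) := by
        refine Finset.sum_le_sum fun e _ => ?_
        simp only [edgeIntegral]
        rw [← integral_finsetSum _ fun i hi => hint e i (by simpa using hi)]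
        refine integral_mono (integrableOn_of_continuousOn (G.isCompact_edge e) (hF e))
          (integrable_finsetSum _ fun i hi => hint e i (by simpa using hi)) fun x => ?_
        rw [sum_adj e fun i => g i x]
        exact h e x
    _ = ∑ i, ∑ e ∈ Finset.univ.filter (G.Adj · i), G.edgeIntegral e (g i) := by
        simp only [Finset.sum_filter]
        exact Finset.sum_comm
    _ = ∑ i, G.bdryIntegral i (g i) :=
        Finset.sum_congr rfl fun i _ => (G.bdryIntegral_eq_sum i (hg i)).symm

lemma IsCoefficient.flux_continuousOn (hκ : G.IsCoefficient κ) (Φ : G.Spectrum κ) {i : ι}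
    {u : Plane → ℝ} (hu : u ∈ G.localSpace i) :
    ContinuousOn (G.flux κ i u) (frontier (G.block i)) :=
  traceSpace_continuousOn (hκ.flux_spec Φ hu).1

lemma IsCoefficient.avgFlux_continuousOn (hκ : G.IsCoefficient κ) (Φ : G.Spectrum κ)
    {u : ι → Plane → ℝ} (hu : u ∈ G.brokenSpace) (e : ε) :
    ContinuousOn (G.avgFlux κ e u) (G.edge e) := by
  rw [mem_brokenSpace] at hu
  have hc : ∀ i, G.Adj e i → ContinuousOn (G.flux κ i (u i)) (G.edge e) := fun i h =>
    (hκ.flux_continuousOn Φ (hu i)).mono (G.edge_subset_frontier h)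
  unfold avgFlux
  cases h : G.minus e with
  | none => exact hc _ (adj_plus e)
  | some j => exact ((hc _ (adj_plus e)).sub (hc j (adj_minus h))).div_const 2

lemma IsCoefficient.avgFlux_add (hκ : G.IsCoefficient κ) (Φ : G.Spectrum κ)
    {u v : ι → Plane → ℝ} (hu : u ∈ G.brokenSpace) (hv : v ∈ G.brokenSpace) (e : ε) (x : Plane) :
    G.avgFlux κ e (u + v) x = G.avgFlux κ e u x + G.avgFlux κ e v x := by
  rw [mem_brokenSpace] at hu hv
  unfold avgFlux
  cases G.minus e with
  | none => simp only [Option.elim, Pi.add_apply, hκ.flux_add Φ (hu _) (hv _)]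
  | some j => simp only [Option.elim, Pi.add_apply, hκ.flux_add Φ (hu _) (hv _)]; ring

lemma IsCoefficient.avgFlux_smul (hκ : G.IsCoefficient κ) (Φ : G.Spectrum κ) (c : ℝ)
    {u : ι → Plane → ℝ} (hu : u ∈ G.brokenSpace) (e : ε) (x : Plane) :
    G.avgFlux κ e (c • u) x = c * G.avgFlux κ e u x := by
  rw [mem_brokenSpace] at hu
  unfold avgFlux
  cases G.minus e with
  | none => simp only [Option.elim, Pi.smul_apply, hκ.flux_smul Φ c (hu _), smul_eq_mul]
  | some j => simp only [Option.elim, Pi.smul_apply, hκ.flux_smul Φ c (hu _), smul_eq_mul]; ring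

variable {γ : ℝ}

lemma aDG_comm (u v : ι → Plane → ℝ) : G.aDG κ γ u v = G.aDG κ γ v u := by
  have h1 : ∀ i, G.stiffness κ i (u i) (v i) = G.stiffness κ i (v i) (u i) := fun i =>
    stiffness_comm i _ _
  have h2 : ∀ e, G.edgeIntegral e
      (fun x => G.avgFlux κ e u x * G.jump e v x + G.avgFlux κ e v x * G.jump e u x) =
      G.edgeIntegral e
      (fun x => G.avgFlux κ e v x * G.jump e u x + G.avgFlux κ e u x * G.jump e v x) := fun e => by
    simp only [add_comm]
  have h3 : ∀ e, G.edgeIntegral e (fun x => G.kbar κ e * G.jump e u x * G.jump e v x) =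
      G.edgeIntegral e (fun x => G.kbar κ e * G.jump e v x * G.jump e u x) := fun e => by
    simp only [mul_assoc, mul_comm (G.jump e u _)]
  simp only [aDG, h1, h2, h3]

omit [Fintype ι] [Fintype ε] in
lemma edgeIntegral_of_eq_add {e : ε} {F f g : Plane → ℝ} (hf : ContinuousOn f (G.edge e))
    (hg : ContinuousOn g (G.edge e)) (h : ∀ x, F x = f x + g x) :
    G.edgeIntegral e F = G.edgeIntegral e f + G.edgeIntegral e g := by
  rw [funext h]
  exact integral_add (integrableOn_of_continuousOn (G.isCompact_edge e) hf)
    (integrableOn_of_continuousOn (G.isCompact_edge e) hg)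

omit [Fintype ι] [Fintype ε] in
lemma edgeIntegral_const_mul (e : ε) (c : ℝ) (g : Plane → ℝ) :
    G.edgeIntegral e (fun x => c * g x) = c * G.edgeIntegral e g :=
  integral_const_mul c g

lemma IsCoefficient.aDG_add_left (hκ : G.IsCoefficient κ) (Φ : G.Spectrum κ)
    {u u' v : ι → Plane → ℝ} (hu : u ∈ G.brokenSpace) (hu' : u' ∈ G.brokenSpace)
    (hv : v ∈ G.brokenSpace) :
    G.aDG κ γ (u + u') v = G.aDG κ γ u v + G.aDG κ γ u' v := by
  have h1 : ∀ i, G.stiffness κ i ((u + u') i) (v i) =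
      G.stiffness κ i (u i) (v i) + G.stiffness κ i (u' i) (v i) := fun i =>
    hκ.stiffness_add_left (mem_brokenSpace.1 hu i) (mem_brokenSpace.1 hu' i)
      (mem_brokenSpace.1 hv i)
  have hF := fun {u} (hu : u ∈ G.brokenSpace) e => hκ.avgFlux_continuousOn Φ hu e
  have h2 : ∀ e, G.edgeIntegral e
      (fun x => G.avgFlux κ e (u + u') x * G.jump e v x + G.avgFlux κ e v x * G.jump e (u + u') x) =
      G.edgeIntegral e
        (fun x => G.avgFlux κ e u x * G.jump e v x + G.avgFlux κ e v x * G.jump e u x) +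
      G.edgeIntegral e
        (fun x => G.avgFlux κ e u' x * G.jump e v x + G.avgFlux κ e v x * G.jump e u' x) := by
    intro e
    refine edgeIntegral_of_eq_add
      (((hF hu e).mul (jump_continuousOn hv e)).add ((hF hv e).mul (jump_continuousOn hu e)))
      (((hF hu' e).mul (jump_continuousOn hv e)).add ((hF hv e).mul (jump_continuousOn hu' e)))
      fun x => ?_
    rw [hκ.avgFlux_add Φ hu hu', jump_add]
    ring
  have h3 : ∀ e, G.edgeIntegral e (fun x => G.kbar κ e * G.jump e (u + u') x * G.jump e v x) =
      G.edgeIntegral e (fun x => G.kbar κ e * G.jump e u x * G.jump e v x) +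
      G.edgeIntegral e (fun x => G.kbar κ e * G.jump e u' x * G.jump e v x) := by
    intro e
    refine edgeIntegral_of_eq_add
      ((continuousOn_const.mul (jump_continuousOn hu e)).mul (jump_continuousOn hv e))
      ((continuousOn_const.mul (jump_continuousOn hu' e)).mul (jump_continuousOn hv e)) fun x => ?_
    rw [jump_add]
    ring
  simp only [aDG, h1, h2, h3, mul_add, Finset.sum_add_distrib]
  ring

lemma IsCoefficient.aDG_smul_left (hκ : G.IsCoefficient κ) (Φ : G.Spectrum κ) (c : ℝ)
    {u : ι → Plane → ℝ} (hu : u ∈ G.brokenSpace) (v : ι → Plane → ℝ) :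
    G.aDG κ γ (c • u) v = c * G.aDG κ γ u v := by
  have h1 : ∀ i, G.stiffness κ i ((c • u) i) (v i) = c * G.stiffness κ i (u i) (v i) := fun i =>
    stiffness_smul_left c (mem_brokenSpace.1 hu i) _
  have h2 : ∀ e, G.edgeIntegral e
      (fun x => G.avgFlux κ e (c • u) x * G.jump e v x + G.avgFlux κ e v x * G.jump e (c • u) x) =
      c * G.edgeIntegral e
        (fun x => G.avgFlux κ e u x * G.jump e v x + G.avgFlux κ e v x * G.jump e u x) := by
    intro e
    rw [← edgeIntegral_const_mul]
    congr 1
    funext x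
    rw [hκ.avgFlux_smul Φ c hu, jump_smul]
    ring
  have h3 : ∀ e, γ / G.fineSize *
      G.edgeIntegral e (fun x => G.kbar κ e * G.jump e (c • u) x * G.jump e v x) =
      c * (γ / G.fineSize *
        G.edgeIntegral e (fun x => G.kbar κ e * G.jump e u x * G.jump e v x)) := by
    intro e
    rw [mul_left_comm c, ← edgeIntegral_const_mul e c]
    congr 2
    funext x
    rw [jump_smul]
    ring
  simp only [aDG, h1, h2, h3, ← Finset.mul_sum]
  ring

/-- The interior penalty form on the fine scale space. -/
def IsCoefficient.dgForm (hκ : G.IsCoefficient κ) (Φ : G.Spectrum κ) (γ : ℝ) :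
    LinearMap.BilinForm ℝ G.brokenSpace :=
  LinearMap.mk₂ ℝ (fun u v => G.aDG κ γ u v)
    (fun u u' v => hκ.aDG_add_left Φ u.2 u'.2 v.2)
    (fun c u v => hκ.aDG_smul_left Φ c u.2 v)
    (fun u v v' => by
      simp only [aDG_comm (u : ι → Plane → ℝ)]
      exact hκ.aDG_add_left Φ v.2 v'.2 u.2)
    (fun c u v => by
      simp only [aDG_comm (u : ι → Plane → ℝ)]
      exact hκ.aDG_smul_left Φ c v.2 u)

lemma IsCoefficient.dgForm_apply (hκ : G.IsCoefficient κ) (Φ : G.Spectrum κ)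
    (u v : G.brokenSpace) : hκ.dgForm Φ γ u v = G.aDG κ γ u v := rfl

/-- The penalty term `∑_E ∫_E κ̄ [v]²` of the interior penalty form, without the factor `γ / h`. -/
def penalty (G : Grid ι ε) (κ : Plane → ℝ) (v : ι → Plane → ℝ) : ℝ :=
  ∑ e, G.edgeIntegral e fun x => G.kbar κ e * G.jump e v x * G.jump e v x

omit [Fintype ι] in
lemma IsCoefficient.penalty_nonneg (hκ : G.IsCoefficient κ) (v : ι → Plane → ℝ) :
    0 ≤ G.penalty κ v :=
  Finset.sum_nonneg fun e _ => G.edgeIntegral_nonneg e fun x => by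
    rw [mul_assoc]
    exact mul_nonneg (zero_le_one.trans (hκ.one_le_kbar e)) (mul_self_nonneg _)

/-- The jumps are controlled by the boundary values; the factor `2` is the number of blocks at an
interior edge. -/
lemma IsCoefficient.penalty_le (hκ : G.IsCoefficient κ) {v : ι → Plane → ℝ}
    (hv : v ∈ G.brokenSpace) :
    G.penalty κ v ≤ ∑ i, 2 * (G.ktilde κ i * G.bdryIntegral i fun x => v i x ^ 2) := by
  have h := sum_edgeIntegral_le (G := G)
    (F := fun e x => G.kbar κ e * G.jump e v x * G.jump e v x)
    (g := fun i x => 2 * (G.ktilde κ i * v i x ^ 2))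
    (fun e => (continuousOn_const.mul (jump_continuousOn hv e)).mul (jump_continuousOn hv e))
    (fun i => continuousOn_const.mul (continuousOn_const.mul
      ((continuousOn_frontier (mem_brokenSpace.1 hv i)).pow 2))) ?_
  · refine h.trans_eq (Finset.sum_congr rfl fun i _ => ?_)
    simp only [bdryIntegral, integral_const_mul]
  · intro e x
    have hk := hκ.one_le_kbar e
    have h1 := kbar_le_ktilde (κ := κ) (adj_plus (G := G) e)
    unfold jump
    cases h : G.minus e with
    | none =>
      simp only [Option.elim]
      nlinarith [mul_le_mul_of_nonneg_right h1 (sq_nonneg (v (G.plus e) x)),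
        mul_nonneg (zero_le_one.trans hk) (sq_nonneg (v (G.plus e) x))]
    | some j =>
      have h2 := kbar_le_ktilde (κ := κ) (adj_minus h)
      simp only [Option.elim]
      nlinarith [mul_le_mul_of_nonneg_right h1 (sq_nonneg (v (G.plus e) x)),
        mul_le_mul_of_nonneg_right h2 (sq_nonneg (v j x)),
        mul_nonneg (zero_le_one.trans hk) (sq_nonneg (v (G.plus e) x + v j x))]

/-- The consistency term `∑_E ∫_E {κ ∇v · n_E} [v]`; it enters `a_DG(v, v)` twice. -/
def consistency (G : Grid ι ε) (κ : Plane → ℝ) (v : ι → Plane → ℝ) : ℝ :=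
  ∑ e, G.edgeIntegral e fun x => G.avgFlux κ e v x * G.jump e v x

lemma energySq_eq (v : ι → Plane → ℝ) :
    G.energySq κ γ v = ∑ i, G.stiffness κ i (v i) (v i) - 2 * G.consistency κ v +
      γ / G.fineSize * G.penalty κ v := by
  simp only [energySq, aDG, consistency, penalty, ← two_mul, edgeIntegral_const_mul,
    ← Finset.mul_sum]

/-- Young's inequality on an edge between two blocks, where `a` and `b` are the outward fluxes of
the blocks, `k` and `l` their coefficient bounds and `J` is the jump; the sign `s = ±1` gives a
two-sided bound. -/
lemma young_interior {a b k l J s t : ℝ} (hk : 1 ≤ k) (hl : 1 ≤ l) (ht : 0 < t) (hs : s ^ 2 = 1) :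
    2 * s * ((a - b) / 2 * J) - t⁻¹ * ((k + l) / 2 * J * J) ≤
      t * k⁻¹ * a ^ 2 + t * l⁻¹ * b ^ 2 := by
  have hk0 : 0 < k := by linarith
  have hl0 : 0 < l := by linarith
  have e1 : 0 ≤ (t * s * a - k * J / 2) ^ 2 * (t⁻¹ * k⁻¹) := by positivity
  have e2 : 0 ≤ (t * s * b + l * J / 2) ^ 2 * (t⁻¹ * l⁻¹) := by positivity
  have f1 : (t * s * a - k * J / 2) ^ 2 * (t⁻¹ * k⁻¹) =
      t * k⁻¹ * a ^ 2 - s * a * J + t⁻¹ * k * J ^ 2 / 4 := by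
    have : (t * s * a - k * J / 2) ^ 2 = s ^ 2 * t ^ 2 * a ^ 2 - t * s * a * k * J
      + k ^ 2 * J ^ 2 / 4 := by ring
    rw [this, hs]
    field_simp
  have f2 : (t * s * b + l * J / 2) ^ 2 * (t⁻¹ * l⁻¹) =
      t * l⁻¹ * b ^ 2 + s * b * J + t⁻¹ * l * J ^ 2 / 4 := by
    have : (t * s * b + l * J / 2) ^ 2 = s ^ 2 * t ^ 2 * b ^ 2 + t * s * b * l * J
      + l ^ 2 * J ^ 2 / 4 := by ring
    rw [this, hs]
    field_simp
  have e3 : 0 ≤ t⁻¹ * (k + l) * J ^ 2 := by positivity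
  rw [f1] at e1
  rw [f2] at e2
  nlinarith

/-- Young's inequality on a boundary edge. -/
lemma young_boundary {a k J s t : ℝ} (hk : 1 ≤ k) (ht : 0 < t) (hs : s ^ 2 = 1) :
    2 * s * (a * J) - t⁻¹ * (k * J * J) ≤ t * k⁻¹ * a ^ 2 := by
  have hk0 : 0 < k := by linarith
  have e1 : 0 ≤ (t * s * a - k * J) ^ 2 * (t⁻¹ * k⁻¹) := by positivity
  have f1 : (t * s * a - k * J) ^ 2 * (t⁻¹ * k⁻¹) =
      t * k⁻¹ * a ^ 2 - 2 * s * (a * J) + t⁻¹ * (k * J * J) := by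
    have : (t * s * a - k * J) ^ 2 = s ^ 2 * t ^ 2 * a ^ 2 - 2 * t * s * a * k * J
      + k ^ 2 * J ^ 2 := by ring
    rw [this, hs]
    field_simp
  linarith

lemma IsCoefficient.consistency_young (hκ : G.IsCoefficient κ) (Φ : G.Spectrum κ) [Nonempty ι]
    {v : ι → Plane → ℝ} (hv : v ∈ G.brokenSpace) {s t : ℝ} (ht : 0 < t) (hs : s ^ 2 = 1) :
    2 * s * G.consistency κ v ≤
      t * (G.invConst κ ^ 2 * G.fineSize⁻¹) * ∑ i, G.stiffness κ i (v i) (v i) +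
        t⁻¹ * G.penalty κ v := by
  have hvl := mem_brokenSpace.1 hv
  have hF := fun e => hκ.avgFlux_continuousOn Φ hv e
  have hJ := fun e => jump_continuousOn hv e
  have hFJ : ∀ e, ContinuousOn (fun x => G.avgFlux κ e v x * G.jump e v x) (G.edge e) := fun e =>
    (hF e).mul (hJ e)
  have hKJ : ∀ e, ContinuousOn (fun x => G.kbar κ e * G.jump e v x * G.jump e v x) (G.edge e) :=
    fun e => (continuousOn_const.mul (hJ e)).mul (hJ e)
  have h := sum_edgeIntegral_le (G := G)
    (F := fun e x => 2 * s * (G.avgFlux κ e v x * G.jump e v x) +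
      -t⁻¹ * (G.kbar κ e * G.jump e v x * G.jump e v x))
    (g := fun i x => t * (G.kmax κ i)⁻¹ * G.flux κ i (v i) x ^ 2)
    (fun e => (continuousOn_const.mul (hFJ e)).add (continuousOn_const.mul (hKJ e)))
    (fun i => continuousOn_const.mul ((hκ.flux_continuousOn Φ (hvl i)).pow 2)) ?_
  · have h1 : ∑ e, G.edgeIntegral e (fun x => 2 * s * (G.avgFlux κ e v x * G.jump e v x) +
        -t⁻¹ * (G.kbar κ e * G.jump e v x * G.jump e v x)) =
        2 * s * G.consistency κ v - t⁻¹ * G.penalty κ v := by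
      rw [consistency, penalty, Finset.mul_sum, Finset.mul_sum, ← Finset.sum_sub_distrib]
      refine Finset.sum_congr rfl fun e _ => ?_
      rw [edgeIntegral_of_eq_add
        (f := fun x => 2 * s * (G.avgFlux κ e v x * G.jump e v x))
        (g := fun x => -t⁻¹ * (G.kbar κ e * G.jump e v x * G.jump e v x))
        (continuousOn_const.mul (hFJ e)) (continuousOn_const.mul (hKJ e)) fun x => rfl,
        edgeIntegral_const_mul, edgeIntegral_const_mul]
      ring
    have h2 : ∑ i, G.bdryIntegral i (fun x => t * (G.kmax κ i)⁻¹ * G.flux κ i (v i) x ^ 2) ≤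
        t * (G.invConst κ ^ 2 * G.fineSize⁻¹) * ∑ i, G.stiffness κ i (v i) (v i) := by
      rw [Finset.mul_sum]
      refine Finset.sum_le_sum fun i _ => ?_
      have hk := hκ.one_le_kmax i
      have hk0 : 0 < G.kmax κ i := by linarith
      have h3 := hκ.bdryIntegral_flux_sq_le Φ (hvl i)
      rw [bdryIntegral, integral_const_mul]
      calc _ ≤ t * (G.kmax κ i)⁻¹ * (G.kmax κ i * G.invConst κ ^ 2 * G.fineSize⁻¹ *
            G.stiffness κ i (v i) (v i)) := mul_le_mul_of_nonneg_left h3 (by positivity)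
        _ = _ := by field_simp
    linarith
  · intro e x
    unfold avgFlux jump kbar
    cases G.minus e with
    | none =>
      have := young_boundary (a := G.flux κ (G.plus e) (v (G.plus e)) x)
        (J := v (G.plus e) x) (hκ.one_le_kmax (G.plus e)) ht hs
      simp only [Option.elim]
      linarith
    | some j =>
      have := young_interior (a := G.flux κ (G.plus e) (v (G.plus e)) x)
        (b := G.flux κ j (v j) x) (J := v (G.plus e) x - v j x)
        (hκ.one_le_kmax (G.plus e)) (hκ.one_le_kmax j) ht hs
      simp only [Option.elim]
      linarith

/-- The consistency term is small relative to the energy, with the factor `C_inv γ^{-1/2}`, by the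
optimal choice of the parameter in Young's inequality. -/
lemma IsCoefficient.consistency_le (hκ : G.IsCoefficient κ) (Φ : G.Spectrum κ) [Nonempty ι]
    (hγ : 0 < γ) {v : ι → Plane → ℝ} (hv : v ∈ G.brokenSpace) {s : ℝ} (hs : s ^ 2 = 1) :
    2 * s * G.consistency κ v ≤ G.invConst κ / √γ *
      (∑ i, G.stiffness κ i (v i) (v i) + γ / G.fineSize * G.penalty κ v) := by
  have hh := G.fineSize_pos
  have hC := (hκ.invConst_spec Φ).1
  have hS : 0 ≤ ∑ i, G.stiffness κ i (v i) (v i) :=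
    Finset.sum_nonneg fun i _ => hκ.stiffness_self_nonneg i _
  have hP := hκ.penalty_nonneg v
  set c := G.invConst κ / √γ with hc
  have hc0 : 0 ≤ c := by positivity
  have hcsq : G.invConst κ ^ 2 = c ^ 2 * γ := by
    rw [hc, div_pow, Real.sq_sqrt hγ.le]; field_simp
  -- the inverse constant may vanish, so the optimal parameter is approached from above
  refine ge_of_tendsto (f := fun c' : ℝ => c' * (∑ i, G.stiffness κ i (v i) (v i) +
    γ / G.fineSize * G.penalty κ v)) (x := 𝓝[>] c)
    ((continuous_id.mul continuous_const).tendsto' c _ rfl |>.mono_left nhdsWithin_le_nhds) ?_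
  filter_upwards [self_mem_nhdsWithin] with c' hc'
  have hc' : c < c' := hc'
  have hc'0 : 0 < c' := hc0.trans_lt hc'
  have h := hκ.consistency_young Φ hv (t := G.fineSize / (γ * c')) (by positivity) hs
  have e1 : G.fineSize / (γ * c') * (G.invConst κ ^ 2 * G.fineSize⁻¹) ≤ c' := by
    rw [hcsq]
    have : G.fineSize / (γ * c') * (c ^ 2 * γ * G.fineSize⁻¹) = c ^ 2 / c' := by field_simp
    rw [this, div_le_iff₀ hc'0]
    nlinarith
  have e2 : (G.fineSize / (γ * c'))⁻¹ * G.penalty κ v =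
      c' * (γ / G.fineSize * G.penalty κ v) := by
    field_simp
  rw [e2] at h
  have e3 := mul_le_mul_of_nonneg_right e1 hS
  linarith

lemma IsCoefficient.a0_mul_stiffness_le (hκ : G.IsCoefficient κ) (Φ : G.Spectrum κ) [Nonempty ι]
    (hγ : 0 < γ) (ha : 0 ≤ G.a0 κ γ) {v : ι → Plane → ℝ} (hv : v ∈ G.brokenSpace) :
    G.a0 κ γ * ∑ i, G.stiffness κ i (v i) (v i) ≤ G.energySq κ γ v := by
  have h := hκ.consistency_le Φ hγ hv (s := 1) (by norm_num)
  have hP : 0 ≤ γ / G.fineSize * G.penalty κ v :=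
    mul_nonneg (div_nonneg hγ.le G.fineSize_pos.le) (hκ.penalty_nonneg v)
  have h2 := mul_nonneg ha hP
  rw [energySq_eq]
  unfold a0 at *
  linarith

lemma IsCoefficient.energySq_nonneg (hκ : G.IsCoefficient κ) (Φ : G.Spectrum κ) [Nonempty ι]
    (hγ : 0 < γ) (ha : 0 ≤ G.a0 κ γ) {v : ι → Plane → ℝ} (hv : v ∈ G.brokenSpace) :
    0 ≤ G.energySq κ γ v :=
  (mul_nonneg ha (Finset.sum_nonneg fun i _ => hκ.stiffness_self_nonneg i _)).trans
    (hκ.a0_mul_stiffness_le Φ hγ ha hv)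

lemma IsCoefficient.energySq_le (hκ : G.IsCoefficient κ) (Φ : G.Spectrum κ) [Nonempty ι]
    (hγ : 0 < γ) {v : ι → Plane → ℝ} (hv : v ∈ G.brokenSpace) :
    G.energySq κ γ v ≤ G.a1 κ γ * ∑ i, (G.stiffness κ i (v i) (v i) +
      2 * (γ / G.fineSize) * (G.ktilde κ i * G.bdryIntegral i fun x => v i x ^ 2)) := by
  have h := hκ.consistency_le Φ hγ hv (s := -1) (by norm_num)
  have hh := G.fineSize_pos
  have hC := (hκ.invConst_spec Φ).1
  have ha1 : 0 ≤ G.a1 κ γ := by unfold a1; positivity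
  have h1 : G.energySq κ γ v ≤ G.a1 κ γ *
      (∑ i, G.stiffness κ i (v i) (v i) + γ / G.fineSize * G.penalty κ v) := by
    rw [energySq_eq]
    unfold a1
    linarith
  refine h1.trans (mul_le_mul_of_nonneg_left ?_ ha1)
  rw [Finset.sum_add_distrib]
  gcongr
  refine (mul_le_mul_of_nonneg_left (hκ.penalty_le hv) (div_pos hγ hh).le).trans_eq ?_
  rw [Finset.mul_sum]
  exact Finset.sum_congr rfl fun i _ => by ring

end DG
end Grid

/-! ### Functionals on the snapshot spaces -/

namespace Grid

section Residual

variable {ι ε : Type*} [Fintype ι] [Fintype ε] {G : Grid ι ε} {κ : Plane → ℝ}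

/-- Linearity of a functional on `V_h(K_i)`. -/
structure IsLinearOn (G : Grid ι ε) (i : ι) (R : (Plane → ℝ) → ℝ) : Prop where
  add : ∀ v ∈ G.localSpace i, ∀ w ∈ G.localSpace i, R (v + w) = R v + R w
  smul : ∀ (c : ℝ), ∀ v ∈ G.localSpace i, R (c • v) = c * R v

namespace Spectrum

variable (Φ : G.Spectrum κ) {J : ι × Fin 2} {R : (Plane → ℝ) → ℝ}

/-- The square of the dual norm of a functional on the snapshot space `V_J`, computed in the
orthogonal eigenbasis. -/
def dualSq (J : ι × Fin 2) (R : (Plane → ℝ) → ℝ) : ℝ :=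
  ∑ k, R (Φ.vec J k) ^ 2 / G.mass κ J (Φ.vec J k) (Φ.vec J k)

/-- The Riesz representative in the snapshot space `V_J` of a functional. -/
def riesz (J : ι × Fin 2) (R : (Plane → ℝ) → ℝ) : Plane → ℝ :=
  Φ.comb J fun k => R (Φ.vec J k) / G.mass κ J (Φ.vec J k) (Φ.vec J k)

variable {Φ} (hκ : G.IsCoefficient κ)
include hκ

omit [Fintype ι] [Fintype ε] in
lemma map_comb (hR : IsLinearOn G J.1 R) (c : Fin (Φ.dim J) → ℝ) :
    R (Φ.comb J c) = ∑ k, c k * R (Φ.vec J k) := by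
  let L : G.localSpace J.1 →ₗ[ℝ] ℝ :=
    { toFun := fun v => R v
      map_add' := fun v w => hR.add v v.2 w w.2
      map_smul' := fun a v => hR.smul a v v.2 }
  rw [← coe_sum_vecL hκ]
  change L (∑ k, c k • vecL hκ Φ J k) = _
  simp only [map_sum, map_smul, smul_eq_mul]
  rfl

lemma dualSq_nonneg : 0 ≤ Φ.dualSq J R :=
  Finset.sum_nonneg fun k _ => div_nonneg (sq_nonneg _) (mass_vec_pos hκ J k).le

omit [Fintype ι] [Fintype ε] in
lemma map_riesz (hR : IsLinearOn G J.1 R) : R (Φ.riesz J R) = Φ.dualSq J R := by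
  rw [riesz, map_comb hκ hR, dualSq]
  exact Finset.sum_congr rfl fun k _ => by ring

lemma mass_riesz : G.mass κ J (Φ.riesz J R) (Φ.riesz J R) = Φ.dualSq J R := by
  rw [riesz, mass_comb hκ, dualSq]
  refine Finset.sum_congr rfl fun k _ => ?_
  have := (mass_vec_pos hκ J k).ne'
  field_simp

lemma sq_le_dualSq_mul_mass (hR : IsLinearOn G J.1 R) {v : Plane → ℝ} (hv : v ∈ G.snap κ J) :
    R v ^ 2 ≤ Φ.dualSq J R * G.mass κ J v v := by
  obtain ⟨c, rfl⟩ := Φ.exists_comb hv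
  rw [map_comb hκ hR, mass_comb hκ, dualSq]
  refine Finset.sum_sq_le_sum_mul_sum_of_sq_le_mul _
    (fun k _ => div_nonneg (sq_nonneg _) (mass_vec_pos hκ J k).le)
    (fun k _ => mass_comb_nonneg_terms hκ J c k) fun k _ => le_of_eq ?_
  have := (mass_vec_pos hκ J k).ne'
  field_simp

lemma iSup_eq_sqrt_dualSq (hR : IsLinearOn G J.1 R) :
    ⨆ v : G.snap κ J, |R v| / √(G.mass κ J v v) = √(Φ.dualSq J R) := by
  have hle : ∀ v : G.snap κ J, |R v| / √(G.mass κ J v v) ≤ √(Φ.dualSq J R) := fun v => by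
    refine div_le_of_le_mul₀ (Real.sqrt_nonneg _) (Real.sqrt_nonneg _) ?_
    rw [← Real.sqrt_mul (dualSq_nonneg hκ)]
    exact Real.abs_le_sqrt (sq_le_dualSq_mul_mass hκ hR v.2)
  refine le_antisymm (ciSup_le hle) ?_
  refine le_trans (le_of_eq ?_) (le_ciSup (f := fun v : G.snap κ J =>
    |R v| / √(G.mass κ J v v)) ⟨_, Set.forall_mem_range.2 hle⟩ ⟨Φ.riesz J R, Φ.comb_mem J _⟩)
  simp only
  rw [map_riesz hκ hR, mass_riesz hκ, abs_of_nonneg (dualSq_nonneg hκ), Real.div_sqrt]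

/-- A functional that vanishes on the first `l` eigenfunctions is bounded in the energy norm by its
dual norm times `λ_{l+1}^{-1/2}`. -/
lemma sq_le_dualSq_mul_stiffness (hR : IsLinearOn G J.1 R) {l : ℕ} (hl : J.2 = 0 → 1 ≤ l)
    (h0 : ∀ k : Fin (Φ.dim J), (k : ℕ) < l → R (Φ.vec J k) = 0) {v : Plane → ℝ}
    (hv : v ∈ G.snap κ J) :
    R v ^ 2 ≤ Φ.dualSq J R * Φ.invVal J l * G.stiffness κ J.1 v v := by
  obtain ⟨c, rfl⟩ := Φ.exists_comb hv
  rw [map_comb hκ hR, mul_assoc, stiffness_comb hκ, dualSq, Finset.mul_sum]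
  have hτ := invVal_nonneg (Φ := Φ) hκ J l
  refine Finset.sum_sq_le_sum_mul_sum_of_sq_le_mul _
    (fun k _ => div_nonneg (sq_nonneg _) (mass_vec_pos hκ J k).le)
    (fun k _ => ?_) fun k _ => ?_
  · have h1 := mass_comb_nonneg_terms hκ J c k
    have h2 := val_nonneg hκ J k
    have : Φ.invVal J l * (c k * c k * (Φ.val J k * G.mass κ J (Φ.vec J k) (Φ.vec J k))) =
      Φ.invVal J l * Φ.val J k * (c k * c k * G.mass κ J (Φ.vec J k) (Φ.vec J k)) := by ring
    rw [this]
    positivity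
  · rcases lt_or_ge (k : ℕ) l with hk | hk
    · rw [h0 k hk]; simp
    · have h1 := one_le_invVal_mul_val hκ hl hk
      have hm := mass_vec_pos hκ J k
      calc (c k * R (Φ.vec J k)) ^ 2 ≤ (c k * R (Φ.vec J k)) ^ 2 * (Φ.invVal J l * Φ.val J k) :=
            le_mul_of_one_le_right (sq_nonneg _) h1
        _ = _ := by field_simp

omit [Fintype ι] [Fintype ε] hκ in
lemma localOff_le_snap (l : ℕ) : Φ.localOff J l ≤ G.snap κ J := by
  rw [← Φ.span_vec J]
  exact Submodule.span_mono (Set.image_subset_range _ _)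

omit [Fintype ι] [Fintype ε] hκ in
lemma vec_mem_localOff {l : ℕ} {k : Fin (Φ.dim J)} (hk : (k : ℕ) < l) :
    Φ.vec J k ∈ Φ.localOff J l := Submodule.subset_span ⟨k, hk, rfl⟩

omit [Fintype ι] [Fintype ε] hκ in
lemma localOff_mono {l l' : ℕ} (h : l ≤ l') : Φ.localOff J l ≤ Φ.localOff J l' :=
  Submodule.span_mono (Set.image_mono fun _ hk => lt_of_lt_of_le hk h)

omit [Fintype ι] [Fintype ε] hκ in
lemma exists_comb_of_mem_localOff {l : ℕ} {w : Plane → ℝ} (hw : w ∈ Φ.localOff J l) :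
    ∃ d : Fin (Φ.dim J) → ℝ, (∀ k : Fin (Φ.dim J), l ≤ (k : ℕ) → d k = 0) ∧ w = Φ.comb J d := by
  induction hw using Submodule.span_induction with
  | mem x hx =>
    obtain ⟨k, hk, rfl⟩ := hx
    refine ⟨Pi.single k 1, fun k' hk' => Pi.single_eq_of_ne ?_ _, (Φ.comb_single k).symm⟩
    rintro rfl
    exact absurd hk (not_lt.2 hk')
  | zero => exact ⟨0, fun _ _ => rfl, by simp [comb]⟩
  | add x y _ _ hx hy =>
    obtain ⟨c, hc, rfl⟩ := hx
    obtain ⟨d, hd, rfl⟩ := hy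
    exact ⟨c + d, fun k hk => by simp [hc k hk, hd k hk],
      by simp [comb, add_smul, Finset.sum_add_distrib]⟩
  | smul a x _ hx =>
    obtain ⟨c, hc, rfl⟩ := hx
    exact ⟨a • c, fun k hk => by simp [hc k hk], by simp [comb, Finset.smul_sum, smul_smul]⟩

omit [Fintype ι] in
/-- The projection is realized by truncating the eigenfunction expansion. -/
lemma proj_mem {v : Plane → ℝ} (hv : v ∈ G.snap κ J) (l : ℕ) : Φ.proj J l v ∈ Φ.localOff J l := by
  refine (Classical.epsilon_spec (p := fun p => p ∈ Φ.localOff J l ∧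
    ∀ w ∈ Φ.localOff J l, G.mass κ J p w = G.mass κ J v w) ?_).1
  obtain ⟨c, rfl⟩ := Φ.exists_comb hv
  refine ⟨Φ.comb J fun k => if (k : ℕ) < l then c k else 0, ?_, fun w hw => ?_⟩
  · refine sum_mem fun k _ => ?_
    dsimp only
    split_ifs with hk
    · exact Submodule.smul_mem _ _ (vec_mem_localOff hk)
    · simp
  · obtain ⟨d, hd, rfl⟩ := exists_comb_of_mem_localOff hw
    rw [mass_comb hκ, mass_comb hκ]
    refine Finset.sum_congr rfl fun k _ => ?_
    split_ifs with hk
    · rfl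
    · simp [hd k (not_lt.1 hk)]

omit [Fintype ι] [Fintype ε] in
lemma off_le_brokenSpace (l : ι × Fin 2 → ℕ) : Φ.off l ≤ G.brokenSpace := by
  intro u hu
  rw [mem_brokenSpace]
  intro i
  have h1 : u i ∈ Φ.localOff (i, 0) (l (i, 0)) ⊔ Φ.localOff (i, 1) (l (i, 1)) :=
    (Submodule.mem_pi.1 hu) i (Set.mem_univ i)
  exact sup_le ((localOff_le_snap _).trans (hκ.snap_le (i, 0)))
    ((localOff_le_snap _).trans (hκ.snap_le (i, 1))) h1

omit [Fintype ι] [Fintype ε] hκ in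
lemma off_mono {l l' : ι × Fin 2 → ℕ} (h : ∀ J, l J ≤ l' J) : Φ.off l ≤ Φ.off l' := by
  intro u hu
  refine Submodule.mem_pi.2 fun i hi => ?_
  exact sup_le_sup (localOff_mono (h _)) (localOff_mono (h _)) (Submodule.mem_pi.1 hu i hi)

omit [Fintype ι] [Fintype ε] hκ in
lemma single_mem_off [DecidableEq ι] {l : ι × Fin 2 → ℕ} {v : Plane → ℝ}
    (hv : v ∈ Φ.localOff J (l J)) : Pi.single J.1 v ∈ Φ.off l := by
  refine Submodule.mem_pi.2 fun i _ => ?_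
  by_cases hi : i = J.1
  · subst hi
    rw [Pi.single_eq_same]
    obtain ⟨i, j⟩ := J
    match j with
    | 0 => exact Submodule.mem_sup_left hv
    | 1 => exact Submodule.mem_sup_right hv
  · rw [Pi.single_eq_of_ne hi]
    exact zero_mem _

end Spectrum

/-! ### Residuals and the a posteriori error estimate -/

variable [DecidableEq ι] {γ : ℝ} {f : Plane → ℝ}

omit [Fintype ι] [Fintype ε] in
lemma single_mem_brokenSpace {i : ι} {v : Plane → ℝ} (hv : v ∈ G.localSpace i) :
    Pi.single i v ∈ G.brokenSpace := by
  rw [mem_brokenSpace]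
  intro i'
  by_cases hi : i' = i
  · subst hi; simpa using hv
  · rw [Pi.single_eq_of_ne hi]; exact zero_mem _

lemma IsCoefficient.aDG_isLinearOn (hκ : G.IsCoefficient κ) (Φ : G.Spectrum κ)
    {u : ι → Plane → ℝ} (hu : u ∈ G.brokenSpace) (i : ι) :
    IsLinearOn G i fun v => G.aDG κ γ u (Pi.single i v) where
  add v hv w hw := by
    rw [Pi.single_add, aDG_comm, hκ.aDG_add_left Φ (single_mem_brokenSpace hv)
      (single_mem_brokenSpace hw) hu, aDG_comm, aDG_comm (Pi.single i w)]
  smul c v hv := by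
    rw [Pi.single_smul, aDG_comm, hκ.aDG_smul_left Φ c (single_mem_brokenSpace hv), aDG_comm]

omit [Fintype ι] [Fintype ε] [DecidableEq ι] in
lemma integrableOn_load (hf : MemLp f 2 (volume.restrict G.domain)) {i : ι} {v : Plane → ℝ}
    (hv : v ∈ G.localSpace i) : IntegrableOn (fun x => f x * v x) (G.block i) := by
  have h1 : MemLp f 2 (volume.restrict (G.block i)) :=
    hf.mono_measure (Measure.restrict_mono (G.block_subset_domain i) le_rfl)
  have h2 : IntegrableOn f (G.block i) := h1.integrable (by norm_num)
  exact h2.mul_continuousOn hv.1 (G.isCompact_block i)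

omit [Fintype ι] [Fintype ε] [DecidableEq ι] in
lemma load_isLinearOn (hf : MemLp f 2 (volume.restrict G.domain)) (i : ι) :
    IsLinearOn G i fun v => ∫ x in G.block i, f x * v x where
  add v hv w hw := by
    rw [← integral_add (integrableOn_load hf hv) (integrableOn_load hf hw)]
    simp only [Pi.add_apply, mul_add]
  smul c v _ := by
    rw [← integral_const_mul]
    simp only [Pi.smul_apply, smul_eq_mul, mul_left_comm]

lemma IsCoefficient.residual_isLinearOn (hκ : G.IsCoefficient κ) (Φ : G.Spectrum κ)
    (hf : MemLp f 2 (volume.restrict G.domain)) {u : ι → Plane → ℝ} (hu : u ∈ G.brokenSpace)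
    (J : ι × Fin 2) : IsLinearOn G J.1 (Φ.residual γ f u J) where
  add v hv w hw := by
    have h1 := (load_isLinearOn hf J.1).add v hv w hw
    have h2 := (hκ.aDG_isLinearOn Φ (γ := γ) hu J.1).add v hv w hw
    rw [Spectrum.residual, Spectrum.residual, Spectrum.residual, h1, h2]
    ring
  smul c v hv := by
    have h1 := (load_isLinearOn hf J.1).smul c v hv
    have h2 := (hκ.aDG_isLinearOn Φ (γ := γ) hu J.1).smul c v hv
    rw [Spectrum.residual, Spectrum.residual, h1, h2]
    ring

lemma IsCoefficient.aDG_eq_sum_single (hκ : G.IsCoefficient κ) (Φ : G.Spectrum κ)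
    {u v : ι → Plane → ℝ} (hu : u ∈ G.brokenSpace) (hv : v ∈ G.brokenSpace) :
    G.aDG κ γ u v = ∑ i, G.aDG κ γ u (Pi.single i (v i)) := by
  have hs : (⟨v, hv⟩ : G.brokenSpace) =
      ∑ i, ⟨Pi.single i (v i), single_mem_brokenSpace (mem_brokenSpace.1 hv i)⟩ := by
    apply Subtype.ext
    rw [AddSubmonoidClass.coe_finsetSum]
    exact (Finset.univ_sum_single v).symm
  have := congrArg (hκ.dgForm Φ γ ⟨u, hu⟩) hs
  rw [map_sum] at this
  exact this

omit [Fintype ε] in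
lemma load_single (i : ι) (v : Plane → ℝ) :
    G.load f (Pi.single i v) = ∫ x in G.block i, f x * v x := by
  rw [load, Finset.sum_eq_single i]
  · simp
  · intro j _ hj
    simp [Pi.single_eq_of_ne hj]
  · simp

/-- Galerkin orthogonality: the residual vanishes on the local offline spaces. -/
lemma residual_eq_zero {Φ : G.Spectrum κ} {l : ι × Fin 2 → ℕ} {u : ι → Plane → ℝ}
    (hu : G.IsGalerkin κ γ f (Φ.off l) u) {J : ι × Fin 2} {v : Plane → ℝ}
    (hv : v ∈ Φ.localOff J (l J)) : Φ.residual γ f u J v = 0 := by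
  rw [Spectrum.residual, hu.2 _ (Spectrum.single_mem_off hv), load_single, sub_self]

variable {Φ : G.Spectrum κ} (hκ : G.IsCoefficient κ)
include hκ

lemma IsCoefficient.etaSq_eq (hf : MemLp f 2 (volume.restrict G.domain))
    {u : ι → Plane → ℝ} (hu : u ∈ G.brokenSpace) (l : ι × Fin 2 → ℕ) (J : ι × Fin 2) :
    Φ.etaSq γ f l u J = Φ.dualSq J (Φ.residual γ f u J) * Φ.invVal J (l J) := by
  rw [Spectrum.etaSq, Spectrum.residualNorm,
    Spectrum.iSup_eq_sqrt_dualSq hκ (hκ.residual_isLinearOn Φ hf hu J),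
    Real.sq_sqrt (Spectrum.dualSq_nonneg hκ)]

lemma IsCoefficient.etaSq_nonneg (hf : MemLp f 2 (volume.restrict G.domain))
    {u : ι → Plane → ℝ} (hu : u ∈ G.brokenSpace) (l : ι × Fin 2 → ℕ) (J : ι × Fin 2) :
    0 ≤ Φ.etaSq γ f l u J := by
  rw [hκ.etaSq_eq hf hu]
  exact mul_nonneg (Spectrum.dualSq_nonneg hκ) (Spectrum.invVal_nonneg hκ J _)

/-- At a Galerkin solution the quantities `S_J` and `η_J` agree, as the residual does not see the
projection onto the offline space. -/
lemma IsCoefficient.S_sq_eq (hf : MemLp f 2 (volume.restrict G.domain)) {l : ι × Fin 2 → ℕ}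
    {u : ι → Plane → ℝ} (hu : G.IsGalerkin κ γ f (Φ.off l) u) (J : ι × Fin 2) :
    Φ.S γ f l u J ^ 2 = Φ.etaSq γ f l u J := by
  have hub := Spectrum.off_le_brokenSpace hκ l hu.1
  have hR := hκ.residual_isLinearOn Φ hf (γ := γ) hub J
  have hproj : ∀ v : G.snap κ J,
      Φ.residual γ f u J (v - Φ.proj J (l J) v) = Φ.residual γ f u J v := fun v => by
    have hp := Spectrum.proj_mem (Φ := Φ) hκ v.2 (l J)
    have hpl := hκ.snap_le J (Spectrum.localOff_le_snap _ hp)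
    rw [sub_eq_add_neg, ← neg_one_smul ℝ, hR.add _ (hκ.snap_le J v.2) _
      (Submodule.smul_mem _ _ hpl), hR.smul _ _ hpl, residual_eq_zero hu hp, mul_zero, add_zero]
  simp only [Spectrum.S, hproj]
  rw [Spectrum.iSup_eq_sqrt_dualSq hκ hR, mul_pow, Real.sq_sqrt (Spectrum.invVal_nonneg hκ J _),
    Real.sq_sqrt (Spectrum.dualSq_nonneg hκ), hκ.etaSq_eq hf hub, mul_comm]

omit [Fintype ι] [Fintype ε] [DecidableEq ι] in
lemma IsCoefficient.stiffness_add_of_harmonic_bubble {i : ι} {p b : Plane → ℝ}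
    (hp : p ∈ G.harmonicSpace κ i) (hb : b ∈ G.bubbleSpace i) :
    G.stiffness κ i (p + b) (p + b) = G.stiffness κ i p p + G.stiffness κ i b b := by
  obtain ⟨hpl, ho⟩ := hκ.mem_harmonicSpace.1 hp
  have h0 := ho b hb
  rw [hκ.stiffness_add_left hpl hb.1 (add_mem hpl hb.1), stiffness_comm i p,
    stiffness_comm i b (p + b), hκ.stiffness_add_left hpl hb.1 hpl,
    hκ.stiffness_add_left hpl hb.1 hb.1, stiffness_comm i b p, h0]
  ring

/-- The a posteriori error estimate. -/
lemma IsCoefficient.energySq_error_le [Nonempty ι] (hγ : 0 < γ) (ha : 0 < G.a0 κ γ)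
    (hf : MemLp f 2 (volume.restrict G.domain)) {l : ι × Fin 2 → ℕ} (hl : ∀ i, 1 ≤ l (i, 0))
    {u uh : ι → Plane → ℝ} (hu : G.IsGalerkin κ γ f (Φ.off l) u)
    (huh : G.IsGalerkin κ γ f G.brokenSpace uh) :
    G.energySq κ γ (uh - u) ≤ G.errConst κ γ * ∑ J, Φ.etaSq γ f l u J := by
  have hub := Spectrum.off_le_brokenSpace hκ l hu.1
  have heb : uh - u ∈ G.brokenSpace := sub_mem huh.1 hub
  have hel := mem_brokenSpace.1 heb
  choose p hp b hb hpb using fun i => Spectrum.exists_harmonic_add_bubble hκ Φ (hel i)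
  -- the components of the error in the snapshot spaces
  let w : ι × Fin 2 → Plane → ℝ := fun J => if J.2 = 0 then p J.1 else b J.1
  have hw : ∀ J, w J ∈ G.snap κ J := by
    rintro ⟨i, j⟩
    match j with
    | 0 => exact hp i
    | 1 => exact hb i
  have hX : G.energySq κ γ (uh - u) = ∑ J, Φ.residual γ f u J (w J) := by
    have h1 : G.energySq κ γ (uh - u) = ∑ i, Φ.residual γ f u (i, 0) ((uh - u) i) := by
      have h2 : G.aDG κ γ (uh - u) (uh - u) =
          G.aDG κ γ uh (uh - u) - G.aDG κ γ u (uh - u) :=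
        LinearMap.map_sub₂ (hκ.dgForm Φ γ) ⟨uh, huh.1⟩ ⟨u, hub⟩ ⟨_, heb⟩
      rw [energySq, h2, huh.2 _ heb, hκ.aDG_eq_sum_single Φ hub heb, load,
        ← Finset.sum_sub_distrib]
      rfl
    rw [h1, Fintype.sum_prod_type]
    refine Finset.sum_congr rfl fun i _ => ?_
    rw [Fin.sum_univ_two, hpb i, (hκ.residual_isLinearOn Φ hf hub (i, 0)).add _
      (hκ.harmonicSpace_le i (hp i)) _ (hb i).1]
    rfl
  have hS : ∑ J : ι × Fin 2, G.stiffness κ J.1 (w J) (w J) =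
      ∑ i, G.stiffness κ i ((uh - u) i) ((uh - u) i) := by
    rw [Fintype.sum_prod_type]
    refine Finset.sum_congr rfl fun i _ => ?_
    rw [Fin.sum_univ_two, hpb i, hκ.stiffness_add_of_harmonic_bubble (hp i) (hb i)]
    rfl
  have hcs : G.energySq κ γ (uh - u) ^ 2 ≤ (∑ J, Φ.etaSq γ f l u J) *
      ∑ i, G.stiffness κ i ((uh - u) i) ((uh - u) i) := by
    rw [hX, ← hS]
    refine Finset.sum_sq_le_sum_mul_sum_of_sq_le_mul _ (fun J _ => hκ.etaSq_nonneg hf hub l J)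
      (fun J _ => hκ.stiffness_self_nonneg _ _) fun J _ => ?_
    rw [hκ.etaSq_eq hf hub]
    refine Spectrum.sq_le_dualSq_mul_stiffness hκ (hκ.residual_isLinearOn Φ hf hub J) ?_
      (fun k hk => residual_eq_zero hu (Spectrum.vec_mem_localOff hk)) (hw J)
    obtain ⟨i, j⟩ := J
    rintro (rfl : j = 0)
    exact hl i
  have hcoer := hκ.a0_mul_stiffness_le Φ hγ ha.le heb
  have hη : 0 ≤ ∑ J, Φ.etaSq γ f l u J := Finset.sum_nonneg fun J _ => hκ.etaSq_nonneg hf hub l J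
  rw [errConst, inv_mul_eq_div, le_div_iff₀ ha]
  rcases (hκ.energySq_nonneg Φ hγ ha.le heb).eq_or_lt with h0 | hpos
  · rw [← h0, zero_mul]; exact hη
  · have h3 := mul_le_mul_of_nonneg_left hcoer hη
    have h4 := mul_le_mul_of_nonneg_left hcs ha.le
    refine le_of_mul_le_mul_right ?_ hpos
    nlinarith

omit [Fintype ε] [DecidableEq ι] hκ in
lemma Spectrum.le_maxD (l : ι × Fin 2 → ℕ) (J : ι × Fin 2) :
    (Φ.maxVal J + γ * G.coarseSize / G.fineSize) * Φ.invVal J (l J) ≤ Φ.maxD γ l :=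
  le_ciSup (f := fun J => (Φ.maxVal J + γ * G.coarseSize / G.fineSize) * Φ.invVal J (l J))
    (Set.finite_range _).bddAbove J

/-- The weighted dual norms of the functional `a_DG(d, ·)` are controlled by the energy of `d`: test
with the weighted sum of the local Riesz representatives.  The factor `2` from the jumps is at most
the number of edges of a block. -/
lemma IsCoefficient.sum_dualSq_le [Nonempty ι] (hγ : 0 < γ) (ha : 0 < G.a0 κ γ)
    {d : ι → Plane → ℝ} (hd : d ∈ G.brokenSpace) (l : ι × Fin 2 → ℕ) :
    ∑ J, Φ.invVal J (l J) * Φ.dualSq J (fun v => G.aDG κ γ d (Pi.single J.1 v)) ≤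
      G.maxEdges * G.a1 κ γ * Φ.maxD γ l * G.energySq κ γ d := by
  have hlin := fun i => hκ.aDG_isLinearOn Φ (γ := γ) hd i
  set τ : ι × Fin 2 → ℝ := fun J => Φ.invVal J (l J) with hτdef
  set A : ι × Fin 2 → (Plane → ℝ) → ℝ := fun J v => G.aDG κ γ d (Pi.single J.1 v) with hA
  set M : ι × Fin 2 → ℝ := fun J => Φ.dualSq J (A J) with hMdef
  let r : ι × Fin 2 → Plane → ℝ := fun J => Φ.riesz J (A J)
  have hτ : ∀ J, 0 ≤ τ J := fun J => Spectrum.invVal_nonneg hκ J _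
  have hM : ∀ J, 0 ≤ M J := fun J => Spectrum.dualSq_nonneg hκ
  have hr : ∀ J, r J ∈ G.snap κ J := fun J => Φ.comb_mem J _
  have hrl : ∀ J, r J ∈ G.localSpace J.1 := fun J => hκ.snap_le J (hr J)
  have hAr : ∀ J, A J (r J) = M J := fun J => Spectrum.map_riesz hκ (hlin J.1)
  have hmr : ∀ J, G.mass κ J (r J) (r J) = M J := fun J => Spectrum.mass_riesz hκ
  have hsr : ∀ J, G.stiffness κ J.1 (r J) (r J) ≤ Φ.maxVal J * M J := fun J => by
    rw [← hmr J]; exact Spectrum.stiffness_le_maxVal_mass hκ (hr J)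
  have hH := G.coarseSize_pos
  have hh := G.fineSize_pos
  have ha1 : 0 ≤ G.a1 κ γ := by
    have := (hκ.invConst_spec Φ).1
    unfold a1; positivity
  let w : ι → Plane → ℝ := fun i => τ (i, 0) • r (i, 0) + τ (i, 1) • r (i, 1)
  have hwb : w ∈ G.brokenSpace := mem_brokenSpace.2 fun i =>
    add_mem (Submodule.smul_mem _ _ (hrl (i, 0))) (Submodule.smul_mem _ _ (hrl (i, 1)))
  set X := ∑ J, τ J * M J with hX
  have hX0 : 0 ≤ X := Finset.sum_nonneg fun J _ => mul_nonneg (hτ J) (hM J)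
  have hdw : G.aDG κ γ d w = X := by
    rw [hκ.aDG_eq_sum_single Φ hd hwb, hX, Fintype.sum_prod_type]
    refine Finset.sum_congr rfl fun i _ => ?_
    have h1 := (hlin i).add _ (Submodule.smul_mem _ (τ (i, 0)) (hrl (i, 0))) _
      (Submodule.smul_mem _ (τ (i, 1)) (hrl (i, 1)))
    have h2 := (hlin i).smul (τ (i, 0)) _ (hrl (i, 0))
    have h3 := (hlin i).smul (τ (i, 1)) _ (hrl (i, 1))
    rw [Fin.sum_univ_two, ← hAr (i, 0), ← hAr (i, 1)]
    simp only [w, hA]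
    rw [h1, h2, h3]
  have hcs : X ^ 2 ≤ G.energySq κ γ d * G.energySq κ γ w := by
    have := LinearMap.BilinForm.apply_mul_apply_le_of_forall_zero_le (hκ.dgForm Φ γ)
      (fun v => hκ.energySq_nonneg Φ hγ ha.le v.2) ⟨d, hd⟩ ⟨w, hwb⟩
    simp only [hκ.dgForm_apply] at this
    rw [aDG_comm w d, hdw, ← sq] at this
    exact this
  have hloc : ∀ i, G.stiffness κ i (w i) (w i) +
      2 * (γ / G.fineSize) * (G.ktilde κ i * G.bdryIntegral i fun x => w i x ^ 2) ≤
      ∑ j : Fin 2, G.maxEdges * Φ.maxD γ l * (τ (i, j) * M (i, j)) := by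
    intro i
    have h1 : G.stiffness κ i (w i) (w i) ≤ τ (i, 0) ^ 2 * (Φ.maxVal (i, 0) * M (i, 0)) +
        τ (i, 1) ^ 2 * (Φ.maxVal (i, 1) * M (i, 1)) := by
      have hs : ∀ j : Fin 2, G.stiffness κ i (τ (i, j) • r (i, j)) (τ (i, j) • r (i, j)) ≤
          τ (i, j) ^ 2 * (Φ.maxVal (i, j) * M (i, j)) := fun j => by
        rw [stiffness_smul_left _ (hrl (i, j)), stiffness_comm,
          stiffness_smul_left _ (hrl (i, j)), ← mul_assoc, ← sq]
        exact mul_le_mul_of_nonneg_left (hsr (i, j)) (sq_nonneg _)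
      simp only [w]
      rw [hκ.stiffness_add_of_harmonic_bubble (Submodule.smul_mem _ _ (hr (i, 0)))
        (Submodule.smul_mem _ _ (hr (i, 1)))]
      exact add_le_add (hs 0) (hs 1)
    -- the bubble part has no trace
    have h2 : G.ktilde κ i * G.bdryIntegral i (fun x => w i x ^ 2) =
        τ (i, 0) ^ 2 * (G.coarseSize * M (i, 0)) := by
      rw [← hmr (i, 0), mass_zero]
      have h3 : G.bdryIntegral i (fun x => w i x ^ 2) =
          τ (i, 0) ^ 2 * G.bdryIntegral i fun x => r (i, 0) x * r (i, 0) x := by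
        rw [bdryIntegral, bdryIntegral, ← integral_const_mul]
        refine bdryIntegral_congr fun x hx => ?_
        have hb : r (i, 1) x = 0 := (hr (i, 1)).2 x hx
        simp only [w, Pi.add_apply, Pi.smul_apply, smul_eq_mul, hb]
        ring
      rw [h3]
      field_simp
    have hN : (2 : ℝ) ≤ G.maxEdges := by exact_mod_cast G.two_le_maxEdges
    have hD : ∀ j : Fin 2, τ (i, j) ^ 2 * (Φ.maxVal (i, j) * M (i, j)) +
        2 * (γ / G.fineSize) * (τ (i, j) ^ 2 * (G.coarseSize * M (i, j))) ≤
        G.maxEdges * Φ.maxD γ l * (τ (i, j) * M (i, j)) := fun j => by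
      have hΛ := Spectrum.maxVal_nonneg (Φ := Φ) hκ (i, j)
      have h4 : (Φ.maxVal (i, j) + γ * G.coarseSize / G.fineSize) * τ (i, j) ≤ Φ.maxD γ l :=
        Spectrum.le_maxD l (i, j)
      have h5 : 0 ≤ γ * G.coarseSize / G.fineSize := by positivity
      have h6 : 0 ≤ Φ.maxVal (i, j) + γ * G.coarseSize / G.fineSize := by positivity
      calc _ = (Φ.maxVal (i, j) + 2 * (γ * G.coarseSize / G.fineSize)) * τ (i, j) *
            (τ (i, j) * M (i, j)) := by ring
        _ ≤ (2 * (Φ.maxVal (i, j) + γ * G.coarseSize / G.fineSize)) * τ (i, j) *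
            (τ (i, j) * M (i, j)) := by
          have := hτ (i, j)
          have := hM (i, j)
          gcongr
          linarith
        _ = 2 * ((Φ.maxVal (i, j) + γ * G.coarseSize / G.fineSize) * τ (i, j)) *
            (τ (i, j) * M (i, j)) := by ring
        _ ≤ _ := by
          refine mul_le_mul_of_nonneg_right ?_ (mul_nonneg (hτ _) (hM _))
          exact mul_le_mul hN h4 (mul_nonneg h6 (hτ _)) (by linarith)
    have h7 : 0 ≤ 2 * (γ / G.fineSize) * (τ (i, 1) ^ 2 * (G.coarseSize * M (i, 1))) := by
      have := hM (i, 1)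
      positivity
    rw [Fin.sum_univ_two, h2]
    linarith [hD 0, hD 1]
  have hew : G.energySq κ γ w ≤ G.maxEdges * G.a1 κ γ * Φ.maxD γ l * X := by
    refine (hκ.energySq_le Φ hγ hwb).trans ?_
    refine (mul_le_mul_of_nonneg_left (Finset.sum_le_sum fun i _ => hloc i) ha1).trans_eq ?_
    rw [← Fintype.sum_prod_type', ← Finset.mul_sum, ← hX]
    ring
  have hE := hκ.energySq_nonneg Φ hγ ha.le hd
  rcases hX0.eq_or_lt with h0 | hpos
  · rw [← h0]
    have hD0 : 0 ≤ Φ.maxD γ l := by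
      have J : ι × Fin 2 := (Classical.arbitrary ι, 0)
      refine le_trans ?_ (Spectrum.le_maxD l J)
      have := Spectrum.maxVal_nonneg (Φ := Φ) hκ J
      have := hτ J
      positivity
    positivity
  · have h8 := mul_le_mul_of_nonneg_left hew hE
    refine le_of_mul_le_mul_right ?_ hpos
    nlinarith

end Residual
end Grid

/-! ### Real number estimates behind the contraction -/

lemma sq_sub_le {α : ℝ} (hα : 0 < α) (x y : ℝ) :
    (x - y) ^ 2 ≤ (1 + α) * x ^ 2 + (1 + α⁻¹) * y ^ 2 := by
  have h : (1 + α) * x ^ 2 + (1 + α⁻¹) * y ^ 2 - (x - y) ^ 2 = α⁻¹ * (α * x + y) ^ 2 := by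
    field_simp
    ring
  have : 0 ≤ α⁻¹ * (α * x + y) ^ 2 := by positivity
  linarith

lemma marking_factor_mem {θ δ : ℝ} (hθ : 0 < θ) (hθ1 : θ < 1) (hδ : 0 < δ) (hδ1 : δ < 1) :
    0 < (1 - δ) * θ ^ 2 ∧ (1 - δ) * θ ^ 2 < 1 := by
  have h1 : 0 < 1 - δ := by linarith
  refine ⟨by positivity, ?_⟩
  nlinarith [sq_nonneg θ]

lemma rho_pos {α θ δ : ℝ} (hα : 0 < α) (hθ : 0 < θ) (hθ1 : θ < 1) (hδ : 0 < δ) (hδ1 : δ < 1) :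
    0 < rho α θ δ :=
  mul_pos (by linarith) (by linarith [(marking_factor_mem hθ hθ1 hδ hδ1).2])

lemma exists_rho_lt_one {θ δ : ℝ} (hθ : 0 < θ) (hθ1 : θ < 1) (hδ : 0 < δ) (hδ1 : δ < 1) :
    ∃ α : ℝ, 0 < α ∧ rho α θ δ < 1 := by
  obtain ⟨h0, -⟩ := marking_factor_mem hθ hθ1 hδ hδ1
  refine ⟨(1 - δ) * θ ^ 2, h0, ?_⟩
  unfold rho
  nlinarith

lemma contr_mem {θ C δ ρ : ℝ} {L : ℕ → ℝ} {m : ℕ} (hθ : 0 < θ) (hC : 0 < C) (hδ : 0 < δ)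
    (hρ : 0 < ρ) (hL : 0 < L m) (hL' : 0 < L (m + 1)) (hρL : ρ * L m < L (m + 1)) :
    0 < contr θ C δ ρ L m ∧ contr θ C δ ρ L m < 1 := by
  have hx0 : 0 < ρ * L m / L (m + 1) := by positivity
  have hx1 : ρ * L m / L (m + 1) < 1 := (div_lt_one hL').2 hρL
  have hden : 0 < θ ^ 2 + C * δ * L m := by positivity
  have hnum : 0 < θ ^ 2 * (1 - ρ * L m / L (m + 1)) := mul_pos (by positivity) (by linarith)
  have hlt : θ ^ 2 * (1 - ρ * L m / L (m + 1)) / (θ ^ 2 + C * δ * L m) < 1 := by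
    rw [div_lt_one hden]
    have : 0 < C * δ * L m := by positivity
    nlinarith [sq_nonneg θ, mul_pos (pow_pos hθ 2) hx0]
  unfold contr
  exact ⟨by linarith, by linarith [div_pos hnum hden]⟩

/-- The contraction of error plus scaled estimator: the excess `c D` of the estimator
reduction is absorbed by the energy `D` of the update, which Galerkin orthogonality provides, and
part of the error is shifted to the estimator with the a posteriori error estimate `A ≤ C B`. -/
lemma contraction_of_estimator_reduction {θ C δ ρ c A A' B B' D : ℝ} {L : ℕ → ℝ} {m : ℕ}
    (hθ : 0 < θ) (hθ1 : θ < 1) (hC : 0 < C) (hδ : 0 < δ)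
    (hL : 0 < L m) (hL' : 0 < L (m + 1)) (hρL : ρ * L m < L (m + 1))
    (hc : c ≤ δ * L (m + 1)) (hD : 0 ≤ D) (hpyth : A' + D = A) (hred : B' ≤ ρ * B + c * D)
    (hAB : A ≤ C * B) (hB : 0 ≤ B) :
    A' + 1 / (δ * L (m + 1)) * B' ≤ contr θ C δ ρ L m * (A + 1 / (δ * L m) * B) := by
  set x := ρ * L m / L (m + 1) with hx
  have hx1 : x < 1 := (div_lt_one hL').2 hρL
  have hden : 0 < θ ^ 2 + C * δ * L m := by positivity
  set η := θ ^ 2 * (1 - x) / (θ ^ 2 + C * δ * L m) with hη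
  have hη0 : 0 ≤ η := div_nonneg (mul_nonneg (sq_nonneg _) (by linarith)) hden.le
  have hθsq : θ ^ 2 ≤ 1 := by nlinarith
  have hkey : η * (1 + C * δ * L m) ≤ 1 - x := by
    rw [hη, div_mul_eq_mul_div, div_le_iff₀ hden]
    have h1 : 0 < C * δ * L m := by positivity
    have h2 : 0 ≤ 1 - x := by linarith
    nlinarith [mul_nonneg h2 (mul_nonneg h1.le (sub_nonneg.2 hθsq))]
  have h1 : A' + 1 / (δ * L (m + 1)) * B' ≤ A + x * (1 / (δ * L m) * B) := by
    have h2 : 1 / (δ * L (m + 1)) * B' ≤ 1 / (δ * L (m + 1)) * (ρ * B + δ * L (m + 1) * D) := by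
      refine mul_le_mul_of_nonneg_left (hred.trans ?_) (by positivity)
      linarith [mul_le_mul_of_nonneg_right hc hD]
    have h3 : 1 / (δ * L (m + 1)) * (ρ * B + δ * L (m + 1) * D) =
        x * (1 / (δ * L m) * B) + D := by
      rw [hx]; field_simp
    linarith
  refine h1.trans ?_
  have hcontr : contr θ C δ ρ L m = 1 - η := rfl
  rw [hcontr]
  have hb0 : 0 ≤ 1 / (δ * L m) * B := by positivity
  have hAb : A ≤ C * δ * L m * (1 / (δ * L m) * B) := by
    refine hAB.trans_eq ?_
    field_simp
  nlinarith [mul_le_mul_of_nonneg_left hAb hη0, mul_le_mul_of_nonneg_right hkey hb0]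

namespace Grid

/-! ### Runs of the adaptive algorithm -/

section Run

variable {ι ε : Type*} [Fintype ι] [Fintype ε] [DecidableEq ι] {G : Grid ι ε} {κ : Plane → ℝ}
  {γ : ℝ} {f : Plane → ℝ} {Φ : G.Spectrum κ} {θ δ : ℝ} {l : ℕ → ι × Fin 2 → ℕ}
  {I : ℕ → Finset (ι × Fin 2)} {u : ℕ → ι → Plane → ℝ}

namespace Spectrum.IsAdaptiveRun

variable (hrun : Φ.IsAdaptiveRun γ f θ δ l I u)
include hrun

lemma level_le_succ (m : ℕ) (J : ι × Fin 2) : l m J ≤ l (m + 1) J := by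
  by_cases hJ : J ∈ I m
  · exact (hrun.enrich m J hJ).1
  · exact (hrun.unmarked m J hJ).ge

lemma one_le_level (m : ℕ) (i : ι) : 1 ≤ l m (i, 0) := by
  induction m with
  | zero => exact hrun.one_le i
  | succ m ih => exact ih.trans (hrun.level_le_succ m _)

variable (hκ : G.IsCoefficient κ)
include hκ

lemma mem_brokenSpace (m : ℕ) : u m ∈ G.brokenSpace :=
  off_le_brokenSpace hκ _ (hrun.solve m).1

lemma invVal_succ_le (m : ℕ) (J : ι × Fin 2) :
    Φ.invVal J (l (m + 1) J) ≤ Φ.invVal J (l m J) := by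
  refine invVal_antitone hκ ?_ (hrun.level_le_succ m J)
  obtain ⟨i, j⟩ := J
  rintro (rfl : j = 0)
  exact hrun.one_le_level m i

/-- Galerkin orthogonality in the nested offline spaces. -/
lemma pythagoras {uh : ι → Plane → ℝ} (huh : G.IsGalerkin κ γ f G.brokenSpace uh) (m : ℕ) :
    G.energySq κ γ (uh - u (m + 1)) + G.energySq κ γ (u (m + 1) - u m) =
      G.energySq κ γ (uh - u m) := by
  have hb := hrun.mem_brokenSpace hκ
  have hd : u (m + 1) - u m ∈ Φ.off (l (m + 1)) :=
    sub_mem (hrun.solve (m + 1)).1 (off_mono (hrun.level_le_succ m) (hrun.solve m).1)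
  have hdb := off_le_brokenSpace hκ _ hd
  have heb : uh - u (m + 1) ∈ G.brokenSpace := sub_mem huh.1 (hb (m + 1))
  have horth : G.aDG κ γ (uh - u (m + 1)) (u (m + 1) - u m) = 0 := by
    have h1 : G.aDG κ γ (uh - u (m + 1)) (u (m + 1) - u m) =
        G.aDG κ γ uh (u (m + 1) - u m) - G.aDG κ γ (u (m + 1)) (u (m + 1) - u m) :=
      LinearMap.map_sub₂ (hκ.dgForm Φ γ) ⟨uh, huh.1⟩ ⟨u (m + 1), hb (m + 1)⟩ ⟨_, hdb⟩
    rw [h1, huh.2 _ hdb, (hrun.solve (m + 1)).2 _ hd, sub_self]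
  have hsum : uh - u m = (uh - u (m + 1)) + (u (m + 1) - u m) := by abel
  have hadd := add_mem heb hdb
  rw [energySq, energySq, energySq, hsum, hκ.aDG_add_left Φ heb hdb hadd,
    aDG_comm (uh - u (m + 1)) (_ + _), aDG_comm (u (m + 1) - u m) (_ + _),
    hκ.aDG_add_left Φ heb hdb heb, hκ.aDG_add_left Φ heb hdb hdb,
    aDG_comm (u (m + 1) - u m) (uh - u (m + 1)), horth]
  ring

/-- The reduction of the estimator: on marked indices enrichment multiplies the weights
`1 / λ_{l+1}` by at most `δ`, and the change of the residuals is controlled by the energy of the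
update. -/
lemma sum_etaSq_succ_le [Nonempty ι] (hγ : 0 < γ) (ha : 0 < G.a0 κ γ) (hδ1 : δ < 1)
    (hf : MemLp f 2 (volume.restrict G.domain)) {α : ℝ} (hα : 0 < α) (m : ℕ) :
    ∑ J, Φ.etaSq γ f (l (m + 1)) (u (m + 1)) J ≤
      rho α θ δ * ∑ J, Φ.etaSq γ f (l m) (u m) J +
        Φ.levelConst γ α (l (m + 1)) * G.energySq κ γ (u (m + 1) - u m) := by
  have hb := hrun.mem_brokenSpace hκ
  have hdb : u (m + 1) - u m ∈ G.brokenSpace := sub_mem (hb _) (hb _)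
  set d := u (m + 1) - u m with hd
  let N : ℕ → ι × Fin 2 → ℝ := fun m J => Φ.dualSq J (Φ.residual γ f (u m) J)
  let τ : ℕ → ι × Fin 2 → ℝ := fun m J => Φ.invVal J (l m J)
  let M : ι × Fin 2 → ℝ := fun J => Φ.dualSq J (fun v => G.aDG κ γ d (Pi.single J.1 v))
  have hN : ∀ m J, 0 ≤ N m J := fun m J => dualSq_nonneg hκ
  have hτ : ∀ m J, 0 ≤ τ m J := fun m J => invVal_nonneg hκ J _
  have hη : ∀ m J, Φ.etaSq γ f (l m) (u m) J = N m J * τ m J := fun m J =>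
    hκ.etaSq_eq hf (hb m) _ J
  have hres : ∀ J, N (m + 1) J ≤ (1 + α) * N m J + (1 + α⁻¹) * M J := by
    intro J
    simp only [N, M, dualSq, Finset.mul_sum, ← Finset.sum_add_distrib]
    refine Finset.sum_le_sum fun k _ => ?_
    have hv := hκ.snap_le J (Φ.vec_mem J k)
    have h1 : G.aDG κ γ d (Pi.single J.1 (Φ.vec J k)) =
        G.aDG κ γ (u (m + 1)) (Pi.single J.1 (Φ.vec J k)) -
          G.aDG κ γ (u m) (Pi.single J.1 (Φ.vec J k)) :=
      LinearMap.map_sub₂ (hκ.dgForm Φ γ) ⟨_, hb (m + 1)⟩ ⟨_, hb m⟩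
        ⟨_, single_mem_brokenSpace hv⟩
    have h2 : Φ.residual γ f (u (m + 1)) J (Φ.vec J k) =
        Φ.residual γ f (u m) J (Φ.vec J k) - G.aDG κ γ d (Pi.single J.1 (Φ.vec J k)) := by
      rw [h1, residual, residual]; ring
    rw [h2, ← mul_div_assoc, ← mul_div_assoc, ← add_div]
    exact div_le_div_of_nonneg_right (sq_sub_le hα _ _) (mass_vec_pos hκ J k).le
  have hmark := hrun.mark m
  simp only [hη] at hmark ⊢
  -- the weights of the old residuals
  have hold : ∑ J, τ (m + 1) J * N m J ≤ (1 - (1 - δ) * θ ^ 2) * ∑ J, N m J * τ m J := by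
    have h1 : ∑ J, τ (m + 1) J * N m J ≤
        ∑ J, (N m J * τ m J - if J ∈ I m then (1 - δ) * (N m J * τ m J) else 0) := by
      refine Finset.sum_le_sum fun J _ => ?_
      split_ifs with hJ
      · have := mul_le_mul_of_nonneg_right (hrun.enrich m J hJ).2 (hN m J)
        simp only [τ]
        linarith
      · have := mul_le_mul_of_nonneg_right (hrun.invVal_succ_le hκ m J) (hN m J)
        simp only [τ]
        linarith
    rw [Finset.sum_sub_distrib, Finset.sum_ite_mem, Finset.univ_inter, ← Finset.mul_sum] at h1
    have h2 := mul_le_mul_of_nonneg_left hmark (sub_nonneg.2 hδ1.le)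
    linarith
  have hnew := hκ.sum_dualSq_le (Φ := Φ) hγ ha hdb (l (m + 1))
  have hα1 : 0 ≤ 1 + α⁻¹ := by positivity
  calc ∑ J, N (m + 1) J * τ (m + 1) J
      ≤ ∑ J, ((1 + α) * (τ (m + 1) J * N m J) + (1 + α⁻¹) * (τ (m + 1) J * M J)) := by
        refine Finset.sum_le_sum fun J _ => ?_
        have := mul_le_mul_of_nonneg_right (hres J) (hτ (m + 1) J)
        linarith
    _ = (1 + α) * ∑ J, τ (m + 1) J * N m J + (1 + α⁻¹) * ∑ J, τ (m + 1) J * M J := by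
        rw [Finset.sum_add_distrib, ← Finset.mul_sum, ← Finset.mul_sum]
    _ ≤ (1 + α) * ((1 - (1 - δ) * θ ^ 2) * ∑ J, N m J * τ m J) +
        (1 + α⁻¹) * (G.maxEdges * G.a1 κ γ * Φ.maxD γ (l (m + 1)) * G.energySq κ γ d) :=
        add_le_add (mul_le_mul_of_nonneg_left hold (by linarith))
          (mul_le_mul_of_nonneg_left hnew hα1)
    _ = _ := by rw [rho, levelConst]; ring

end Spectrum.IsAdaptiveRun

omit [DecidableEq ι] in
/-- There are finitely many eigenvalues, so the level constants are bounded. -/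
lemma IsCoefficient.exists_levelConst_le (hκ : G.IsCoefficient κ) (Φ : G.Spectrum κ) [Nonempty ι]
    (hγ : 0 < γ) {α : ℝ} (hα : 0 < α) :
    ∃ c, 0 ≤ c ∧ ∀ l : ι × Fin 2 → ℕ, Φ.levelConst γ α l ≤ c := by
  let b : ι × Fin 2 → ℝ := fun J => ∑ k, (Φ.val J k)⁻¹
  have hb : ∀ J, 0 ≤ b J := fun J =>
    Finset.sum_nonneg fun k _ => inv_nonneg.2 (Spectrum.val_nonneg hκ J k)
  let w : ι × Fin 2 → ℝ := fun J => Φ.maxVal J + γ * G.coarseSize / G.fineSize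
  have hH := G.coarseSize_pos
  have hh := G.fineSize_pos
  have hw : ∀ J, 0 ≤ w J := fun J =>
    add_nonneg (Spectrum.maxVal_nonneg hκ J) (by positivity)
  have ha1 : 0 ≤ G.a1 κ γ := by
    have := (hκ.invConst_spec Φ).1
    unfold a1; positivity
  have hpre : 0 ≤ G.maxEdges * (1 + α⁻¹) * G.a1 κ γ := by positivity
  refine ⟨G.maxEdges * (1 + α⁻¹) * G.a1 κ γ * ∑ J, w J * b J,
    mul_nonneg hpre (Finset.sum_nonneg fun J _ => mul_nonneg (hw J) (hb J)), fun l => ?_⟩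
  refine mul_le_mul_of_nonneg_left (ciSup_le fun J => ?_) hpre
  have hinv : Φ.invVal J (l J) ≤ b J := by
    unfold Spectrum.invVal
    split_ifs with hd
    · exact Finset.single_le_sum (f := fun k => (Φ.val J k)⁻¹)
        (fun k _ => inv_nonneg.2 (Spectrum.val_nonneg hκ J k)) (Finset.mem_univ _)
    · exact hb J
  exact (mul_le_mul_of_nonneg_left hinv (hw J)).trans
    (Finset.single_le_sum (f := fun J => w J * b J) (fun J _ => mul_nonneg (hw J) (hb J))
      (Finset.mem_univ J))

end Run

end Grid

end GMsDG

end

theorem mainTheorem3 {ι ε : Type*} [Fintype ι] [DecidableEq ι] [Nonempty ι] [Fintype ε]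
    (G : GMsDG.Grid ι ε) (κ : GMsDG.Plane → ℝ) (hκ_meas : Measurable κ)
    (hκ_one : ∀ x ∈ G.domain, 1 ≤ κ x) (hκ_bdd : BddAbove (κ '' G.domain))
    (γ : ℝ) (hγ : G.invConst κ ^ 2 < γ)
    (Φ : G.Spectrum κ)
    (θ δ : ℝ) (hθ : 0 < θ) (hθ_one : θ < 1) (hδ : 0 < δ) (hδ_one : δ < 1) :
    (∃ α : ℝ, 0 < α ∧ GMsDG.rho α θ δ < 1) ∧
    ∀ α : ℝ, 0 < α → GMsDG.rho α θ δ < 1 →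
      0 < GMsDG.rho α θ δ ∧
      -- some positive constant is admissible for all sources and all runs
      (∃ L : ℝ, 0 < L ∧ ∀ (f : GMsDG.Plane → ℝ) (l : ℕ → ι × Fin 2 → ℕ)
        (I : ℕ → Finset (ι × Fin 2)) (u : ℕ → ι → GMsDG.Plane → ℝ),
        MemLp f 2 (volume.restrict G.domain) → Φ.IsAdaptiveRun γ f θ δ l I u →
        GMsDG.Admissible δ (GMsDG.rho α θ δ) (fun m => Φ.levelConst γ α (l m)) (fun _ => L)) ∧
      ∀ (f : GMsDG.Plane → ℝ) (l : ℕ → ι × Fin 2 → ℕ)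
        (I : ℕ → Finset (ι × Fin 2)) (u : ℕ → ι → GMsDG.Plane → ℝ) (uh : ι → GMsDG.Plane → ℝ),
        MemLp f 2 (volume.restrict G.domain) →
        G.IsGalerkin κ γ f G.brokenSpace uh →
        Φ.IsAdaptiveRun γ f θ δ l I u →
        -- `C_err` is a constant of the a posteriori error estimate
        (∀ m, G.energySq κ γ (uh - u m) ≤
          G.errConst κ γ * ∑ J, Φ.etaSq γ f (l m) (u m) J) ∧
        -- contraction
        (∀ L : ℕ → ℝ,
          GMsDG.Admissible δ (GMsDG.rho α θ δ) (fun m => Φ.levelConst γ α (l m)) L →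
          ∀ m,
            0 < GMsDG.contr θ (G.errConst κ γ) δ (GMsDG.rho α θ δ) L m ∧
            GMsDG.contr θ (G.errConst κ γ) δ (GMsDG.rho α θ δ) L m < 1 ∧
            G.energySq κ γ (uh - u (m + 1))
                + 1 / (δ * L (m + 1)) * ∑ J, Φ.S γ f (l (m + 1)) (u (m + 1)) J ^ 2 ≤
              GMsDG.contr θ (G.errConst κ γ) δ (GMsDG.rho α θ δ) L m *
                (G.energySq κ γ (uh - u m)
                  + 1 / (δ * L m) * ∑ J, Φ.S γ f (l m) (u m) J ^ 2)) ∧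
        -- convergence
        Tendsto (fun m => G.energySq κ γ (uh - u m)) atTop (𝓝 0) := by
  have hκ : G.IsCoefficient κ := ⟨hκ_meas, hκ_one, hκ_bdd⟩
  have hγ0 : 0 < γ := (sq_nonneg _).trans_lt hγ
  have ha0 : 0 < G.a0 κ γ := by
    have h : G.invConst κ < √γ := Real.lt_sqrt_of_sq_lt hγ
    rw [GMsDG.Grid.a0, sub_pos, div_lt_one (Real.sqrt_pos.2 hγ0)]
    exact h
  have hC : 0 < G.errConst κ γ := inv_pos.2 ha0
  refine ⟨GMsDG.exists_rho_lt_one hθ hθ_one hδ hδ_one, fun α hα hρ1 => ?_⟩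
  have hρ := GMsDG.rho_pos hα hθ hθ_one hδ hδ_one
  have hadm : ∃ L : ℝ, 0 < L ∧ ∀ l : ℕ → ι × Fin 2 → ℕ,
      GMsDG.Admissible δ (GMsDG.rho α θ δ) (fun m => Φ.levelConst γ α (l m)) fun _ => L := by
    obtain ⟨c, hc0, hc⟩ := hκ.exists_levelConst_le Φ hγ0 hα
    have hL : 0 < c / δ + 1 := by positivity
    refine ⟨c / δ + 1, hL, fun l m => ⟨hL, (hc (l m)).trans ?_, ?_⟩⟩
    · rw [mul_add, mul_div_cancel₀ _ hδ.ne']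
      linarith
    · exact mul_lt_of_lt_one_left hL hρ1
  refine ⟨hρ, ?_, fun f l I u uh hf huh hrun => ?_⟩
  · obtain ⟨L, hL, h⟩ := hadm
    exact ⟨L, hL, fun f l I u _ _ => h l⟩
  have hub := hrun.mem_brokenSpace hκ
  have herr : ∀ m, G.energySq κ γ (uh - u m) ≤
      G.errConst κ γ * ∑ J, Φ.etaSq γ f (l m) (u m) J := fun m =>
    hκ.energySq_error_le hγ0 ha0 hf (hrun.one_le_level m) (hrun.solve m) huh
  have hcontr : ∀ L : ℕ → ℝ,
      GMsDG.Admissible δ (GMsDG.rho α θ δ) (fun m => Φ.levelConst γ α (l m)) L → ∀ m,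
      0 < GMsDG.contr θ (G.errConst κ γ) δ (GMsDG.rho α θ δ) L m ∧
      GMsDG.contr θ (G.errConst κ γ) δ (GMsDG.rho α θ δ) L m < 1 ∧
      G.energySq κ γ (uh - u (m + 1))
          + 1 / (δ * L (m + 1)) * ∑ J, Φ.S γ f (l (m + 1)) (u (m + 1)) J ^ 2 ≤
        GMsDG.contr θ (G.errConst κ γ) δ (GMsDG.rho α θ δ) L m *
          (G.energySq κ γ (uh - u m)
            + 1 / (δ * L m) * ∑ J, Φ.S γ f (l m) (u m) J ^ 2) := by
    intro L hL m
    obtain ⟨hL0, -, hρL⟩ := hL m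
    obtain ⟨hL1, hc, -⟩ := hL (m + 1)
    obtain ⟨h0, h1⟩ := GMsDG.contr_mem hθ hC hδ hρ hL0 hL1 hρL
    refine ⟨h0, h1, ?_⟩
    simp only [hκ.S_sq_eq hf (hrun.solve _)]
    exact GMsDG.contraction_of_estimator_reduction hθ hθ_one hC hδ hL0 hL1 hρL hc
      (hκ.energySq_nonneg Φ hγ0 ha0.le (sub_mem (hub (m + 1)) (hub m)))
      (hrun.pythagoras hκ huh m) (hrun.sum_etaSq_succ_le hκ hγ0 ha0 hδ_one hf hα m) (herr m)
      (Finset.sum_nonneg fun J _ => hκ.etaSq_nonneg hf (hub m) _ J)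
  refine ⟨herr, hcontr, ?_⟩
  -- with a constant admissible `L` the contraction factor does not depend on the level
  obtain ⟨L, hL, h⟩ := hadm
  have hstep := hcontr (fun _ => L) (h l)
  set q := GMsDG.contr θ (G.errConst κ γ) δ (GMsDG.rho α θ δ) (fun _ => L) 0 with hq
  have hq0 : 0 < q := (hstep 0).1
  have hq1 : q < 1 := (hstep 0).2.1
  have hgeom : ∀ m, G.energySq κ γ (uh - u m)
      + 1 / (δ * L) * ∑ J, Φ.S γ f (l m) (u m) J ^ 2 ≤
      q ^ m * (G.energySq κ γ (uh - u 0) + 1 / (δ * L) * ∑ J, Φ.S γ f (l 0) (u 0) J ^ 2) := by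
    intro m
    induction m with
    | zero => simp
    | succ m ih =>
      refine ((hstep m).2.2.trans (mul_le_mul_of_nonneg_left ih hq0.le)).trans_eq ?_
      rw [pow_succ', mul_assoc]
      rfl
  refine squeeze_zero
    (fun m => hκ.energySq_nonneg Φ hγ0 ha0.le (sub_mem huh.1 (hub m)))
    (fun m => le_trans (le_add_of_nonneg_right (by positivity)) (hgeom m)) ?_
  simpa using (tendsto_pow_atTop_nhds_zero_of_lt_one hq0.le hq1).mul_const
    (G.energySq κ γ (uh - u 0) + 1 / (δ * L) * ∑ J, Φ.S γ f (l 0) (u 0) J ^ 2)
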